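/- Let $(H,\langle\cdot,\cdot\rangle,\|\cdot\|)$ be a real Hilbert space and let $A:D(A)\subset H\to H$ be a (possibly unbounded) strictly positive self-adjoint operator, i.e. $A$ is self-adjoint and $\langle Ax,x\rangle\ge c\|x\|^2$ on $D(A)$ for some $c>0$. Let $H^1=D(A^{1/2})$ with $\langle u,v\rangle_1=\langle A^{1/2}u,A^{1/2}v\rangle$, and let $\mathcal H=H^1\times H^1\times H\times H$ with the product topology. Let $\alpha,\beta,\gamma,\kappa>0$ and $\eta\in\mathbb R$ (no sign condition is imposed on $\gamma-\alpha\beta$). Consider the system $$u_{ttt}+\alpha u_{tt}+\beta Au_t+\gamma Au=\eta A\theta,\qquad \theta_t+\kappa A\theta=-\eta Au_{tt}-\alpha\eta Au_t .$$ A weak solution with initial datum $\boldsymbol u_0\in\mathcal H$ is a function $\boldsymbol u=(u,v,w,\theta)\in\mathcal C([0,\infty),\mathcal H)$ with $\boldsymbol u(0)=\boldsymbol u_0$ such that, for every $t\ge 0$, $u_t=v$ and $v_t=w$ in $H$, and, for all $\varphi,\psi\in D(A)$, $$\tfrac{d}{dt}\langle w,\varphi\rangle+\alpha\langle w,\varphi\rangle+\beta\langle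 v,A\varphi\rangle+\gamma\langle u,A\varphi\rangle=\eta\langle\theta,A\varphi\rangle,$$ $$\tfrac{d}{dt}\langle\theta,\psi\rangle+\kappa\langle\theta,A\psi\rangle=-\eta\langle w,A\psi\rangle-\alpha\eta\langle v,A\psi\rangle$$ (one-sided derivatives at $t=0$). Then for every $\boldsymbol u_0\in\mathcal H$ there is a unique weak solution $\boldsymbol u\in\mathcal C([0,\infty),\mathcal H)$ with initial datum $\boldsymbol u_0$. Moreover, for every fixed $t\ge0$ the map $S(t):\boldsymbol u_0\mapsto\boldsymbol u(t)$ is a continuous linear operator on $\mathcal H$, and $(S(t))_{t\ge0}$ is a strongly continuous semigroup: $S(0)=I$, $S(s+t)=S(s)S(t)$ for all $s,t\ge0$, and $t\mapsto S(t)\boldsymbol u_0$ is continuous on $[0,\infty)$ for every $\boldsymbol u_0\in\mathcal H$. -/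

import Mathlib

open Filter Topology Set
open scoped NNReal

section SquareRoot

variable {H : Type*} [NormedAddCommGroup H] [InnerProductSpace ℝ H] [CompleteSpace H]

/-- `B` is a nonnegative self-adjoint square root of the (unbounded) operator `A`:
`B ∘ B = A`, including equality of the natural domains. -/
structure IsPositiveSqrt (B A : H →ₗ.[ℝ] H) : Prop where
  isSelfAdjoint : IsSelfAdjoint B
  nonneg : ∀ x : B.domain, 0 ≤ inner ℝ (B x) (x : H)
  mem_graph_iff : ∀ x y : H,
    (x, y) ∈ A.graph ↔ ∃ z : H, (x, z) ∈ B.graph ∧ (z, y) ∈ B.graph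

variable (H) in
/-- A strictly positive self-adjoint operator on the real Hilbert space `H`, in general unbounded:
`c ‖x‖² ≤ ⟪A x, x⟫` on the domain of `A`, for some `c > 0`. Density of the domain is part of
self-adjointness (`IsSelfAdjoint.dense_domain`). -/
structure StrictlyPositiveOperator where
  op : H →ₗ.[ℝ] H
  isSelfAdjoint : IsSelfAdjoint op
  exists_lower_bound : ∃ c : ℝ, 0 < c ∧
    ∀ x : op.domain, c * ‖(x : H)‖ ^ 2 ≤ inner ℝ (op x) (x : H)

/-- The square root of `1 - R` for a self-adjoint contraction `R`. -/
theorem exists_bounded_sqrt (R : H →L[ℝ] H) (hR : ‖R‖ ≤ 1) (hs : IsSelfAdjoint R) :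
    ∃ Y : H →L[ℝ] H, ‖Y‖ ≤ 1 ∧ IsSelfAdjoint Y ∧ (1 - Y) * (1 - Y) = 1 - R := by
  let Y : ℕ → (H →L[ℝ] H) := fun n => Nat.rec 0 (fun _ Z => (1 / 2 : ℝ) • (R + Z * Z)) n
  let y : ℕ → ℝ := fun n => Nat.rec 0 (fun _ z => (1 / 2 : ℝ) * (1 + z * z)) n
  have Y0 : Y 0 = 0 := rfl
  have y0 : y 0 = 0 := rfl
  have YS : ∀ n, Y (n + 1) = (1 / 2 : ℝ) • (R + Y n * Y n) := fun _ => rfl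
  have yS : ∀ n, y (n + 1) = (1 / 2 : ℝ) * (1 + y n * y n) := fun _ => rfl
  have ynn : ∀ n, 0 ≤ y n ∧ y n ≤ 1 := by
    intro n
    induction n with
    | zero => simp [y0]
    | succ n ih =>
      rw [yS]
      constructor <;> nlinarith [ih.1, ih.2]
  have ymono : Monotone y := by
    apply monotone_nat_of_le_succ
    intro n
    rw [yS]
    nlinarith [sq_nonneg (1 - y n)]
  have hYn : ∀ n, ‖Y n‖ ≤ y n := by
    intro n
    induction n with
    | zero => simp [Y0, y0]
    | succ n ih =>
      rw [YS, yS, norm_smul]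
      have h1 : ‖R + Y n * Y n‖ ≤ 1 + y n * y n :=
        (norm_add_le _ _).trans (add_le_add hR ((norm_mul_le _ _).trans
          (mul_le_mul ih ih (norm_nonneg _) (ynn n).1)))
      rw [Real.norm_of_nonneg (by norm_num)]
      linarith
  have hd : ∀ n, ‖Y (n + 1) - Y n‖ ≤ y (n + 1) - y n := by
    intro n
    induction n with
    | zero =>
      have := hYn 1
      simpa [Y0, y0] using this
    | succ n ih =>
      have e : Y (n + 1 + 1) - Y (n + 1) = (1 / 2 : ℝ) •
          (Y (n + 1) * (Y (n + 1) - Y n) + (Y (n + 1) - Y n) * Y n) := by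
        rw [YS (n + 1), YS n, ← YS n, ← smul_sub]
        congr 1
        noncomm_ring
      have f : y (n + 1 + 1) - y (n + 1) = (1 / 2 : ℝ) *
          (y (n + 1) * (y (n + 1) - y n) + (y (n + 1) - y n) * y n) := by
        rw [yS (n + 1)]
        nth_rewrite 3 [yS n]
        ring
      rw [e, f, norm_smul, Real.norm_of_nonneg (by norm_num)]
      have h0 : 0 ≤ y (n + 1) - y n := (norm_nonneg _).trans ih
      have h1 := (norm_mul_le (Y (n + 1)) (Y (n + 1) - Y n)).trans
        (mul_le_mul (hYn (n + 1)) ih (norm_nonneg _) (ynn (n + 1)).1)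
      have h2 := (norm_mul_le (Y (n + 1) - Y n) (Y n)).trans
        (mul_le_mul ih (hYn n) (norm_nonneg _) h0)
      have h3 := norm_add_le (Y (n + 1) * (Y (n + 1) - Y n)) ((Y (n + 1) - Y n) * Y n)
      linarith
  have hsum : Summable fun n => y (n + 1) - y n := by
    apply summable_of_sum_range_le (c := 1)
    · intro n
      exact sub_nonneg.2 (ymono n.le_succ)
    · intro n
      rw [Finset.sum_range_sub, y0]
      linarith [(ynn n).2]
  have hc : CauchySeq Y := by
    apply cauchySeq_of_dist_le_of_summable _ _ hsum
    intro n
    rw [dist_comm, dist_eq_norm]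
    exact hd n
  obtain ⟨Z, hZ⟩ := cauchySeq_tendsto_of_complete hc
  refine ⟨Z, ?_, ?_, ?_⟩
  · exact le_of_tendsto hZ.norm (Eventually.of_forall fun n => (hYn n).trans (ynn n).2)
  · have hsaY : ∀ n, IsSelfAdjoint (Y n) := by
      intro n
      induction n with
      | zero => rw [Y0]; exact IsSelfAdjoint.zero _
      | succ n ih =>
        rw [YS]
        refine IsSelfAdjoint.smul (IsSelfAdjoint.all _) (hs.add ?_)
        have := ih.pow 2
        rwa [pow_two] at this
    have h1 : Tendsto (fun n => star (Y n)) atTop (𝓝 (star Z)) :=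
      (continuous_star.tendsto Z).comp hZ
    have h2 : (fun n => star (Y n)) = Y := funext fun n => hsaY n
    rw [h2] at h1
    exact tendsto_nhds_unique h1 hZ
  · have h1 : Tendsto (fun n => Y (n + 1)) atTop (𝓝 Z) := hZ.comp (tendsto_add_atTop_nat 1)
    have h2 : Tendsto (fun n => Y (n + 1)) atTop (𝓝 ((1 / 2 : ℝ) • (R + Z * Z))) := by
      simp only [YS]
      exact ((hZ.mul hZ).const_add R).const_smul _
    have h3 := tendsto_nhds_unique h1 h2
    have h4 : R = (2 : ℝ) • Z - Z * Z := by
      have h5 : (2 : ℝ) • Z = R + Z * Z := by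
        conv_lhs => rw [h3]
        rw [smul_smul]
        norm_num
      rw [h5]
      abel
    rw [h4, two_smul]
    noncomm_ring

namespace StrictlyPositiveOperator

variable (A : StrictlyPositiveOperator H)

/-- The bounded inverse of `A`, together with its quantitative positivity. -/
theorem exists_inverse : ∃ c : ℝ, 0 < c ∧ ∃ G : H →L[ℝ] H,
    (∀ x y : H, (x, y) ∈ A.op.graph ↔ x = G y) ∧ IsSelfAdjoint G ∧
    ∀ y, c * ‖G y‖ ^ 2 ≤ inner ℝ y (G y) := by
  obtain ⟨c, hc, hA⟩ := A.exists_lower_bound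
  have hb : ∀ x y : H, (x, y) ∈ A.op.graph → c * ‖x‖ ^ 2 ≤ inner ℝ y x := by
    intro x y h
    obtain ⟨z, rfl, rfl⟩ := A.op.mem_graph_iff.1 h
    exact hA z
  have hb' : ∀ x y : H, (x, y) ∈ A.op.graph → ‖x‖ ≤ c⁻¹ * ‖y‖ := by
    intro x y h
    have h1 := (hb x y h).trans (real_inner_le_norm y x)
    rcases (norm_nonneg x).eq_or_lt with h0 | h0
    · rw [← h0]; positivity
    · rw [inv_mul_eq_div, le_div_iff₀ hc]
      have : (‖x‖ * c) * ‖x‖ ≤ ‖y‖ * ‖x‖ := by nlinarith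
      exact le_of_mul_le_mul_right this h0
  have hsym : ∀ x y x' y' : H, (x, y) ∈ A.op.graph → (x', y') ∈ A.op.graph →
      inner ℝ y x' = inner ℝ x y' := by
    intro x y x' y' h h'
    have h2 : (x', y') ∈ A.op.graph.adjoint := by
      rw [← LinearPMap.adjoint_graph_eq_graph_adjoint A.isSelfAdjoint.dense_domain,
        LinearPMap.isSelfAdjoint_def.1 A.isSelfAdjoint]
      exact h'
    have := (Submodule.mem_adjoint_iff _ _).1 h2 x y h
    exact sub_eq_zero.1 this
  let P : A.op.graph →ₗ[ℝ] H := (LinearMap.snd ℝ H H).comp A.op.graph.subtype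
  have hPval : ∀ p : A.op.graph, P p = (p : H × H).2 := fun _ => rfl
  have hcl : _root_.IsClosed (A.op.graph : Set (H × H)) := A.isSelfAdjoint.isClosed
  have : CompleteSpace A.op.graph := hcl.completeSpace_coe
  have hanti : AntilipschitzWith (Real.toNNReal (max c⁻¹ 1)) P := by
    apply AddMonoidHomClass.antilipschitz_of_bound
    intro p
    rw [Real.coe_toNNReal _ (le_max_of_le_right zero_le_one)]
    obtain ⟨⟨x, y⟩, hp⟩ := p
    change max ‖x‖ ‖y‖ ≤ max c⁻¹ 1 * ‖y‖
    apply max_le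
    · exact (hb' x y hp).trans (by gcongr; exact le_max_left _ _)
    · nlinarith [norm_nonneg y, le_max_right c⁻¹ (1 : ℝ)]
  have hPc : UniformContinuous P :=
    (uniformContinuous_snd).comp uniformContinuous_subtype_val
  have hrc : _root_.IsClosed (P.range : Set H) := by
    rw [LinearMap.coe_range]
    exact hanti.isClosed_range hPc
  have : CompleteSpace P.range := hrc.completeSpace_coe
  have hrange : P.range = ⊤ := by
    rw [← Submodule.orthogonal_eq_bot_iff, Submodule.eq_bot_iff]
    intro y hy
    have h1 : (y, (0 : H)) ∈ A.op.graph := by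
      rw [← LinearPMap.isSelfAdjoint_def.1 A.isSelfAdjoint,
        LinearPMap.adjoint_graph_eq_graph_adjoint A.isSelfAdjoint.dense_domain,
        Submodule.mem_adjoint_iff]
      intro a b hab
      have : inner ℝ b y = 0 := hy b ⟨⟨(a, b), hab⟩, rfl⟩
      simp [this]
    have := hb' y 0 h1
    simpa using this
  have hsurj : ∀ y : H, ∃ x : H, (x, y) ∈ A.op.graph := by
    intro y
    have : y ∈ P.range := by rw [hrange]; trivial
    obtain ⟨⟨⟨x, y'⟩, hp⟩, rfl⟩ := this
    exact ⟨x, hp⟩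
  have huniq : ∀ x x' y : H, (x, y) ∈ A.op.graph → (x', y) ∈ A.op.graph → x = x' := by
    intro x x' y h h'
    have h1 : (x - x', (0 : H)) ∈ A.op.graph := by
      simpa using A.op.graph.sub_mem h h'
    have := hb' _ _ h1
    simpa [sub_eq_zero] using this
  choose g hg using hsurj
  let G₀ : H →ₗ[ℝ] H :=
    { toFun := g
      map_add' := fun y y' => huniq _ _ _ (hg _) (A.op.graph.add_mem (hg y) (hg y'))
      map_smul' := fun a y => huniq _ _ _ (hg _) (A.op.graph.smul_mem a (hg y)) }
  let G : H →L[ℝ] H := G₀.mkContinuous c⁻¹ fun y => hb' _ _ (hg y)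
  have hG : ∀ y, G y = g y := fun _ => rfl
  refine ⟨c, hc, G, ?_, ?_, ?_⟩
  · intro x y
    constructor
    · intro h
      exact huniq _ _ _ h (hg y)
    · rintro rfl
      exact hg y
  · rw [ContinuousLinearMap.isSelfAdjoint_iff_isSymmetric]
    intro y y'
    exact (hsym _ _ _ _ (hg y) (hg y')).symm
  · intro y
    exact hb _ _ (hg y)

/-- A strictly positive self-adjoint operator has a nonnegative self-adjoint square root. -/
theorem exists_isPositiveSqrt : ∃ B : H →ₗ.[ℝ] H, IsPositiveSqrt B A.op := by
  obtain ⟨c, hc, G, hG, hGs, hGp⟩ := A.exists_inverse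
  have hR : ‖1 - c • G‖ ≤ 1 := by
    apply ContinuousLinearMap.opNorm_le_bound _ zero_le_one
    intro y
    rw [one_mul]
    apply le_of_sq_le_sq _ (norm_nonneg _)
    have h1 : (1 - c • G) y = y - c • G y := by simp
    rw [h1, norm_sub_sq_real, norm_smul, inner_smul_right, Real.norm_of_nonneg hc.le]
    nlinarith [hGp y, sq_nonneg (c * ‖G y‖)]
  have hRs : IsSelfAdjoint (1 - c • G) :=
    (IsSelfAdjoint.one _).sub (IsSelfAdjoint.smul (IsSelfAdjoint.all _) hGs)
  obtain ⟨Y, hY, hYs, hYY⟩ := exists_bounded_sqrt (1 - c • G) hR hRs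
  have hYp : ∀ y, 0 ≤ inner ℝ y ((1 - Y) y) := by
    intro y
    have h1 : inner ℝ y ((1 - Y) y) = ‖y‖ ^ 2 - inner ℝ y (Y y) := by
      simp [inner_sub_right]
    have h2 := real_inner_le_norm y (Y y)
    have h3 : ‖Y y‖ ≤ ‖y‖ := (Y.le_of_opNorm_le hY y).trans_eq (one_mul _)
    rw [h1]
    nlinarith [norm_nonneg y]
  let T : H →L[ℝ] H := (Real.sqrt c)⁻¹ • (1 - Y)
  have hTT : ∀ y, T (T y) = G y := by
    intro y
    have h1 : T * T = G := by
      simp only [T, smul_mul_smul_comm, hYY]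
      rw [← mul_inv, Real.mul_self_sqrt hc.le, sub_sub_cancel, smul_smul,
        inv_mul_cancel₀ hc.ne', one_smul]
    rw [← h1]; rfl
  have hTs : ∀ y y', inner ℝ (T y) y' = inner ℝ y (T y') := by
    have : IsSelfAdjoint T :=
      IsSelfAdjoint.smul (IsSelfAdjoint.all _) ((IsSelfAdjoint.one _).sub hYs)
    exact ContinuousLinearMap.isSelfAdjoint_iff_isSymmetric.1 this
  have hTp : ∀ y, 0 ≤ inner ℝ y (T y) := by
    intro y
    have : inner ℝ y (T y) = (Real.sqrt c)⁻¹ * inner ℝ y ((1 - Y) y) := by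
      simp only [T, smul_apply, inner_smul_right]
    rw [this]
    exact mul_nonneg (by positivity) (hYp y)
  have hTinj : ∀ y, T y = 0 → y = 0 := by
    intro y hy
    have h1 : (0 : H) = G y := by rw [← hTT, hy, map_zero]
    exact A.op.graph_fst_eq_zero_snd ((hG _ _).2 h1) rfl
  have hker : ((T : H →ₗ[ℝ] H).toPMap ⊤).toFun.ker = ⊥ := by
    rw [LinearMap.ker_eq_bot']
    intro m hm
    exact Subtype.ext (hTinj m hm)
  let B : H →ₗ.[ℝ] H := ((T : H →ₗ[ℝ] H).toPMap ⊤).inverse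
  have hB : ∀ x z : H, (x, z) ∈ B.graph ↔ x = T z := by
    intro x z
    rw [LinearPMap.inverse_graph hker, Submodule.mem_map]
    constructor
    · rintro ⟨⟨a, b⟩, hab, h⟩
      obtain ⟨m, hm1, hm2⟩ := (LinearPMap.mem_graph_iff _).1 hab
      simp only [LinearEquiv.coe_coe, LinearEquiv.prodComm_apply, Prod.swap_prod_mk,
        Prod.mk.injEq] at h
      obtain ⟨rfl, rfl⟩ := h
      dsimp only at hm1 hm2
      rw [← hm2, ← hm1]
      rfl
    · rintro rfl
      exact ⟨(z, T z), (LinearPMap.mem_graph_iff _).2 ⟨⟨z, trivial⟩, rfl, rfl⟩, rfl⟩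
  have hdom : ∀ z, T z ∈ B.domain := fun z =>
    LinearPMap.mem_domain_iff.2 ⟨z, (hB _ _).2 rfl⟩
  have hdense : Dense (B.domain : Set H) := by
    rw [Submodule.dense_iff_topologicalClosure_eq_top,
      Submodule.topologicalClosure_eq_top_iff, Submodule.eq_bot_iff]
    intro y hy
    apply hTinj
    have := hy (T (T y)) (hdom _)
    rw [hTs] at this
    exact inner_self_eq_zero.1 this
  refine ⟨B, ?_, ?_, ?_⟩
  · rw [LinearPMap.isSelfAdjoint_def]
    apply LinearPMap.eq_of_eq_graph
    ext ⟨p, q⟩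
    rw [LinearPMap.adjoint_graph_eq_graph_adjoint hdense, Submodule.mem_adjoint_iff, hB]
    constructor
    · intro h
      apply ext_inner_left ℝ
      intro b
      have := h (T b) b ((hB _ _).2 rfl)
      rw [← hTs]
      exact sub_eq_zero.1 this
    · rintro rfl a b hab
      rw [(hB _ _).1 hab, hTs, sub_self]
  · intro x
    have h := (hB _ _).1 (B.mem_graph x)
    rw [h]
    exact hTp _
  · intro x y
    simp only [hB, hG, ← hTT]
    constructor
    · rintro rfl
      exact ⟨T y, rfl, rfl⟩
    · rintro ⟨z, rfl, rfl⟩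
      rfl

end StrictlyPositiveOperator

end SquareRoot

namespace StrictlyPositiveOperator

variable {H : Type*} [NormedAddCommGroup H] [InnerProductSpace ℝ H] [CompleteSpace H]
variable (A : StrictlyPositiveOperator H)

/-- `A^{1/2}`, the nonnegative self-adjoint square root of `A`. -/
noncomputable def sqrt : H →ₗ.[ℝ] H := A.exists_isPositiveSqrt.choose

theorem isPositiveSqrt_sqrt : IsPositiveSqrt A.sqrt A.op := A.exists_isPositiveSqrt.choose_spec

theorem sqrt_injective {x : A.sqrt.domain} (hx : A.sqrt x = 0) : x = 0 := by
  have h1 : ((x : H), (0 : H)) ∈ A.sqrt.graph := by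
    have := A.sqrt.mem_graph x
    rwa [hx] at this
  have h2 : ((x : H), (0 : H)) ∈ A.op.graph :=
    (A.isPositiveSqrt_sqrt.mem_graph_iff _ _).2 ⟨0, h1, Submodule.zero_mem _⟩
  obtain ⟨z, hz1, hz2⟩ := A.op.mem_graph_iff.1 h2
  obtain ⟨c, hc, hA⟩ := A.exists_lower_bound
  have h3 := hA z
  dsimp only at hz1 hz2
  rw [hz1, hz2, inner_zero_left] at h3
  have h4 : ‖(x : H)‖ ^ 2 = 0 := le_antisymm (by nlinarith) (sq_nonneg _)
  exact Subtype.ext (by simpa using h4)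

/-- The space `H¹ = D(A^{1/2})`. -/
def H1 : Type _ := A.sqrt.domain

noncomputable instance : AddCommGroup A.H1 := inferInstanceAs (AddCommGroup A.sqrt.domain)

noncomputable instance : Module ℝ A.H1 := inferInstanceAs (Module ℝ A.sqrt.domain)

/-- The inclusion of `H¹` into `H`. -/
noncomputable def incl : A.H1 →ₗ[ℝ] H := A.sqrt.domain.subtype

/-- `A^{1/2}` as a linear map from `H¹` to `H`. -/
noncomputable def sqrtMap : A.H1 →ₗ[ℝ] H := A.sqrt.toFun

/-- The inner product `⟪u, v⟫₁ = ⟪A^{1/2} u, A^{1/2} v⟫` of `H¹`. -/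
@[reducible] noncomputable def h1Core : InnerProductSpace.Core ℝ A.H1 where
  inner u v := inner ℝ (A.sqrtMap u) (A.sqrtMap v)
  conj_inner_symm u v := by simp [real_inner_comm]
  re_inner_nonneg u := by simp
  add_left u v w := by simp [inner_add_left]
  smul_left u v r := by simp [inner_smul_left]
  definite u hu := A.sqrt_injective (inner_self_eq_zero.1 hu)

noncomputable instance : NormedAddCommGroup A.H1 :=
  @InnerProductSpace.Core.toNormedAddCommGroup ℝ A.H1 _ _ _ A.h1Core

noncomputable instance : InnerProductSpace ℝ A.H1 := InnerProductSpace.ofCore A.h1Core.toCore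

/-- The phase space `ℋ = H¹ × H¹ × H × H` of quadruples `(u, v, w, θ)`, with the product
topology and linear structure. -/
abbrev PhaseSpace : Type _ := A.H1 × A.H1 × H × H

/-- `U = (u, v, w, θ) ∈ C([0,∞), ℋ)` is a weak solution, with initial datum `z`, of
`u_ttt + α u_tt + β A u_t + γ A u = η A θ`,  `θ_t + κ A θ = - η A u_tt - α η A u_t`.

Here `v = u_t` and `w = u_tt`, and the two equations hold for every `t ≥ 0` when tested against
elements of `D(A)`, where the duality pairing of `A x` with `φ ∈ D(A)` is `⟪x, A φ⟫`.
Derivatives are relative to `[0,∞)`, hence one-sided at `t = 0`. -/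
structure IsWeakSolution (α β γ κ η : ℝ) (z : A.PhaseSpace) (U : C(ℝ≥0, A.PhaseSpace)) :
    Prop where
  initial : U 0 = z
  deriv_u : ∀ t : ℝ≥0,
    HasDerivWithinAt (fun s : ℝ => A.incl (U s.toNNReal).1) (A.incl (U t).2.1) (Ici 0) t
  deriv_v : ∀ t : ℝ≥0,
    HasDerivWithinAt (fun s : ℝ => A.incl (U s.toNNReal).2.1) (U t).2.2.1 (Ici 0) t
  deriv_w : ∀ (φ : A.op.domain) (t : ℝ≥0),
    HasDerivWithinAt (fun s : ℝ => inner ℝ (U s.toNNReal).2.2.1 (φ : H))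
      (-α * inner ℝ (U t).2.2.1 (φ : H) - β * inner ℝ (A.incl (U t).2.1) (A.op φ)
        - γ * inner ℝ (A.incl (U t).1) (A.op φ) + η * inner ℝ (U t).2.2.2 (A.op φ))
      (Ici 0) t
  deriv_θ : ∀ (ψ : A.op.domain) (t : ℝ≥0),
    HasDerivWithinAt (fun s : ℝ => inner ℝ (U s.toNNReal).2.2.2 (ψ : H))
      (-κ * inner ℝ (U t).2.2.2 (A.op ψ) - η * inner ℝ (U t).2.2.1 (A.op ψ)
        - α * η * inner ℝ (A.incl (U t).2.1) (A.op ψ))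
      (Ici 0) t

end StrictlyPositiveOperator

/-- A strongly continuous semigroup of bounded linear operators on `X`. -/
structure IsStronglyContinuousSemigroup {X : Type*} [NormedAddCommGroup X] [NormedSpace ℝ X]
    (S : ℝ≥0 → X →L[ℝ] X) : Prop where
  zero : S 0 = ContinuousLinearMap.id ℝ X
  add : ∀ s t : ℝ≥0, S (s + t) = (S s).comp (S t)
  continuous : ∀ x : X, Continuous fun t : ℝ≥0 => S t x

/-! ### From weak to strong derivatives. -/

section SeparatingFamily

variable {E F : Type*} [NormedAddCommGroup E] [NormedSpace ℝ E]
  [NormedAddCommGroup F] [NormedSpace ℝ F]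

/-! Put `T = A^{-1/2}` and `δ = γ/β`. In the variables `p = A^{1/2}u`, `r = A^{1/2}v + δp`, `ζ = w +
αv`, `θ`, the system reads `p' = r - δp`, `r' = A^{1/2}ζ + (δ - α)(r - δp)`, `ζ' = -βA^{1/2}r +
ηAθ`, `θ' = -κAθ - ηAζ`. For the energy `‖p‖² + β‖r‖² + ‖ζ‖² + ‖θ‖²` the coupling terms in `A^{1/2}`
and `ηA` cancel and `-κA` dissipates. What is left is bounded, so the dynamics is quasi-contractive
whatever the sign of `γ - αβ`.

Replace `A^{1/2}` by the bounded symmetric operators `B n = (T + 1/(n+1))⁻¹` and `A` by `B n ^ 2`.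
The cancellation persists, so the groups `exp(t L n)` are bounded uniformly in `n`
(`norm_expGroup_blockOperator_le`). With `J = T⁴` in every coordinate, `L n * J` converges in
operator norm to a bounded `K`. By Duhamel's formula (`norm_sub_expGroup_le`) the groups converge on
the dense range of `J`, hence everywhere, to a semigroup solving `(J y)' = K y`. The same
comparison, applied to an arbitrary continuous solution, gives uniqueness
(`exists_semigroup_of_approximation`).

Finally, the weak formulation is equivalent to `(J y)' = K y`. Testing against `φ = T²y` for all `y`
moves `T²` onto the solution, and a power of the injective `T` can be removed from a differential
equation whose right-hand side is continuous (`isWeakSolution_iff_coordinates`). -/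

theorem eq_of_hasDerivWithinAt_Ici_zero {f : ℝ → E}
    (h : ∀ t, 0 ≤ t → HasDerivWithinAt f 0 (Ici 0) t) {t : ℝ} (ht : 0 ≤ t) : f t = f 0 := by
  refine constant_of_has_deriv_right_zero (b := t) (fun s hs => ?_) (fun s hs => ?_) t ⟨ht, le_rfl⟩
  · exact (h s hs.1).continuousWithinAt.mono Icc_subset_Ici_self
  · exact (h s hs.1).mono (Ici_subset_Ici.2 hs.1)

/-- A function whose images under a separating family of continuous linear maps have the
images of a continuous `g` as derivatives is itself differentiable, with derivative `g`. -/
theorem hasDerivWithinAt_of_separating [CompleteSpace E] {ι : Type*} (C : ι → E →L[ℝ] F)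
    (hsep : ∀ x, (∀ i, C i x = 0) → x = 0) {f g : ℝ → E} (hg : Continuous g)
    (h : ∀ i t, 0 ≤ t → HasDerivWithinAt (fun s => C i (f s)) (C i (g t)) (Ici 0) t)
    {t : ℝ} (ht : 0 ≤ t) : HasDerivWithinAt f (g t) (Ici 0) t := by
  have hG : ∀ s, HasDerivAt (fun u => ∫ x in (0 : ℝ)..u, g x) (g s) s := fun s =>
    intervalIntegral.integral_hasDerivAt_right (hg.intervalIntegrable _ _)
      (hg.stronglyMeasurableAtFilter _ _) hg.continuousAt
  -- Each `C i` makes `f` minus the primitive of `g` constant, and the family separates points. No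
  -- regularity of `f` itself is needed.
  have key : ∀ s, 0 ≤ s → f s = f 0 + ∫ x in (0 : ℝ)..s, g x := by
    intro s hs
    rw [← sub_eq_zero]
    refine hsep _ fun i => ?_
    have h1 : ∀ u, 0 ≤ u → HasDerivWithinAt
        (fun u => C i (f u) - C i (∫ x in (0 : ℝ)..u, g x)) 0 (Ici 0) u := by
      intro u hu
      simpa using (h i u hu).fun_sub ((C i).hasFDerivAt.comp_hasDerivAt u (hG u)).hasDerivWithinAt
    have h2 := eq_of_hasDerivWithinAt_Ici_zero h1 hs
    simp only [intervalIntegral.integral_same, map_zero, sub_zero] at h2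
    rw [map_sub, map_add, ← h2]
    abel
  refine HasDerivWithinAt.congr ((hG t).hasDerivWithinAt.const_add (f 0)) ?_ (key t ht)
  intro s hs
  exact key s hs

/-- A one-element separating family; this is what removes powers of `T` from the smoothed equations.
-/
theorem hasDerivWithinAt_of_injective [CompleteSpace E] (C : E →L[ℝ] F)
    (hC : Function.Injective C) {f g : ℝ → E} (hg : Continuous g)
    (h : ∀ t, 0 ≤ t → HasDerivWithinAt (fun s => C (f s)) (C (g t)) (Ici 0) t)
    {t : ℝ} (ht : 0 ≤ t) : HasDerivWithinAt f (g t) (Ici 0) t :=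
  hasDerivWithinAt_of_separating (fun _ : Unit => C)
    (fun _ hx => hC ((hx ()).trans (map_zero C).symm)) hg (fun _ => h) ht

theorem ContinuousLinearMap.comp_hasDerivWithinAt (C : E →L[ℝ] F) {f : ℝ → E} {f' : E}
    {s : Set ℝ} {t : ℝ} (h : HasDerivWithinAt f f' s t) :
    HasDerivWithinAt (fun u => C (f u)) (C f') s t :=
  C.hasFDerivAt.comp_hasDerivWithinAt t h

theorem HasDerivWithinAt.components {f : ℝ → E × F} {f' : E × F} {s : Set ℝ} {t : ℝ}
    (h : HasDerivWithinAt f f' s t) :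
    HasDerivWithinAt (fun u => (f u).1) f'.1 s t ∧
      HasDerivWithinAt (fun u => (f u).2) f'.2 s t :=
  ⟨(ContinuousLinearMap.fst ℝ E F).comp_hasDerivWithinAt h,
    (ContinuousLinearMap.snd ℝ E F).comp_hasDerivWithinAt h⟩

end SeparatingFamily

/-! ### Semigroups as strong limits of exponentials of bounded operators. -/

section ApproximatingExponentials

variable {X : Type*} [NormedAddCommGroup X] [NormedSpace ℝ X]

/-- The uniformly continuous group generated by a bounded operator. -/
noncomputable def expGroup (L : X →L[ℝ] X) (t : ℝ) : X →L[ℝ] X := NormedSpace.exp (t • L)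

theorem expGroup_zero (L : X →L[ℝ] X) : expGroup L 0 = 1 := by
  simp [expGroup, NormedSpace.exp_zero]

theorem commute_expGroup {L J : X →L[ℝ] X} (h : Commute J L) (t : ℝ) :
    Commute J (expGroup L t) :=
  Commute.exp_right (h.smul_right t)

variable [CompleteSpace X]

theorem hasDerivAt_expGroup (L : X →L[ℝ] X) (t : ℝ) :
    HasDerivAt (expGroup L) (expGroup L t * L) t :=
  hasDerivAt_exp_smul_const (𝕂 := ℝ) L t

theorem expGroup_add (L : X →L[ℝ] X) (s t : ℝ) :
    expGroup L (s + t) = expGroup L s * expGroup L t := by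
  let _ : NormedAlgebra ℚ (X →L[ℝ] X) := NormedAlgebra.restrictScalars ℚ ℝ _
  rw [expGroup, add_smul]
  exact NormedSpace.exp_add_of_commute (((Commute.refl L).smul_left s).smul_right t)

theorem hasDerivAt_expGroup_apply (L : X →L[ℝ] X) (x : X) (t : ℝ) :
    HasDerivAt (fun s => expGroup L s x) (L (expGroup L t x)) t := by
  have h := (hasDerivAt_expGroup L t).clm_apply (hasDerivAt_const t x)
  have e : expGroup L t * L = L * expGroup L t := (commute_expGroup (Commute.refl L) t).eq.symm
  simpa [e] using h

theorem continuous_expGroup_apply (L : X →L[ℝ] X) (x : X) :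
    Continuous fun s => expGroup L s x :=
  continuous_iff_continuousAt.2 fun t => (hasDerivAt_expGroup_apply L x t).continuousAt

/-- Comparison of a solution of `(J y)' = K y` with the group generated by `L`, when `L J` is
close to `K`. -/
theorem norm_sub_expGroup_le {L J K : X →L[ℝ] X} {y : ℝ → X}
    (hy : ∀ t, 0 ≤ t → HasDerivWithinAt (fun s => J (y s)) (K (y t)) (Ici 0) t)
    {t C D : ℝ} (ht : 0 ≤ t) (hC : ∀ s ∈ Icc 0 t, ‖expGroup L s‖ ≤ C)
    (hD : ∀ s ∈ Icc 0 t, ‖y s‖ ≤ D) :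
    ‖J (y t) - expGroup L t (J (y 0))‖ ≤ C * (‖K - L * J‖ * D) * t := by
  have hC0 : 0 ≤ C := (norm_nonneg _).trans (hC 0 ⟨le_rfl, ht⟩)
  -- Duhamel: this curve joins `exp(tL) J y(0)` to `J y(t)`, and only the defect `K - L J` survives
  -- in its derivative.
  have h1 : ∀ s ∈ Icc 0 t, HasDerivWithinAt (fun s => expGroup L (t - s) (J (y s)))
      (expGroup L (t - s) ((K - L * J) (y s))) (Icc 0 t) s := by
    intro s hs
    have h2 : HasDerivAt (fun s => expGroup L (t - s)) (-(expGroup L (t - s) * L)) s := by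
      have := (hasDerivAt_expGroup L (t - s)).scomp s ((hasDerivAt_id s).const_sub t)
      rw [neg_one_smul] at this
      exact this
    have h3 := h2.hasDerivWithinAt.clm_apply ((hy s hs.1).mono (fun r (hr : r ∈ Icc 0 t) => hr.1))
    convert h3 using 1
    simp [map_sub]
    abel
  have h4 := norm_image_sub_le_of_norm_deriv_le_segment' (C := C * (‖K - L * J‖ * D)) h1
    (fun s hs => ?_) t ⟨ht, le_rfl⟩
  · simpa [expGroup_zero] using h4
  · refine ((expGroup L (t - s)).le_opNorm _).trans ?_
    refine mul_le_mul (hC _ ⟨by linarith [hs.2], by linarith [hs.1]⟩) ?_ (norm_nonneg _) hC0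
    exact ((K - L * J).le_opNorm _).trans
      (mul_le_mul_of_nonneg_left (hD s ⟨hs.1, hs.2.le⟩) (norm_nonneg _))

/-- Bounded operators `L n` generating uniformly bounded groups on `[0,∞)`, whose products with a
commuting injective operator `J` of dense range converge, generate groups converging strongly
to a strongly continuous semigroup, which solves `(J y)' = K y` uniquely. -/
theorem exists_semigroup_of_approximation (L : ℕ → X →L[ℝ] X) (J K : X →L[ℝ] X) {M ω : ℝ}
    (hω : 0 ≤ ω)
    (hbound : ∀ n t, 0 ≤ t → ‖expGroup (L n) t‖ ≤ M * Real.exp (ω * t))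
    (hcomm : ∀ n, Commute J (L n)) (hlim : Tendsto (fun n => L n * J) atTop (𝓝 K))
    (hdense : DenseRange J) (hinj : Function.Injective J) :
    ∃ S : ℝ≥0 → X →L[ℝ] X, IsStronglyContinuousSemigroup S ∧
      (∀ x t, 0 ≤ t → HasDerivWithinAt (fun s : ℝ => J (S s.toNNReal x))
        (K (S t.toNNReal x)) (Ici 0) t) ∧
      ∀ y : ℝ → X, Continuous y →
        (∀ t, 0 ≤ t → HasDerivWithinAt (fun s => J (y s)) (K (y t)) (Ici 0) t) →
        ∀ t : ℝ≥0, y t = S t (y 0) := by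
  have hM : 0 ≤ M := by
    have := (norm_nonneg _).trans (hbound 0 0 le_rfl)
    simpa using this
  have hbound' : ∀ n s t, 0 ≤ s → s ≤ t → ‖expGroup (L n) s‖ ≤ M * Real.exp (ω * t) := by
    intro n s t hs hst
    exact (hbound n s hs).trans (by gcongr)
  have hJE : ∀ n t x, J (expGroup (L n) t x) = expGroup (L n) t (J x) := fun n t x =>
    DFunLike.congr_fun (commute_expGroup (hcomm n) t).eq x
  -- The orbit of `L m` solves `(J y)' = L m J y`, so comparing it with the group of `L n` leaves
  -- the defect `L m J - L n J`, which is small.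
  have hcauchyJ : ∀ t, 0 ≤ t → ∀ x, CauchySeq fun n => expGroup (L n) t (J x) := by
    intro t ht x
    set B := M * Real.exp (ω * t) with hB
    have hB0 : 0 ≤ B := by positivity
    have hest : ∀ m n, ‖expGroup (L m) t (J x) - expGroup (L n) t (J x)‖ ≤
        B * (‖L m * J - L n * J‖ * (B * ‖x‖)) * t := by
      intro m n
      have h := norm_sub_expGroup_le (L := L n) (J := J) (K := L m * J)
        (y := fun s => expGroup (L m) s x) (t := t) (C := B) (D := B * ‖x‖) ?_ ht ?_ ?_
      · simpa [hJE, expGroup_zero] using h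
      · intro s _
        have h := (J.hasFDerivAt.comp_hasDerivAt s (hasDerivAt_expGroup_apply (L m) x s))
        have e : J (L m (expGroup (L m) s x)) = (L m * J) (expGroup (L m) s x) := by
          rw [← (hcomm m).eq]; rfl
        rw [e] at h
        exact h.hasDerivWithinAt
      · exact fun s hs => hbound' n s t hs.1 hs.2
      · exact fun s hs => ((expGroup (L m) s).le_opNorm x).trans
          (mul_le_mul_of_nonneg_right (hbound' m s t hs.1 hs.2) (norm_nonneg _))
    rw [Metric.cauchySeq_iff]
    intro ε hε
    obtain ⟨N, hN⟩ := Metric.cauchySeq_iff.1 hlim.cauchySeq (ε / (B * (B * ‖x‖) * t + 1))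
      (by positivity)
    refine ⟨N, fun m hm n hn => ?_⟩
    have h1 := hN m hm n hn
    rw [dist_eq_norm] at h1 ⊢
    rw [lt_div_iff₀ (by positivity)] at h1
    refine (hest m n).trans_lt (lt_of_le_of_lt ?_ h1)
    nlinarith [norm_nonneg (L m * J - L n * J)]
  -- Density of the range of `J` and the bound uniform in `n`: the two error terms `B * ‖x - J z‖`
  -- cost at most `ε / 2` together.
  have hcauchy : ∀ t, 0 ≤ t → ∀ x, CauchySeq fun n => expGroup (L n) t x := by
    intro t ht x
    set B := M * Real.exp (ω * t) with hB
    have hB0 : 0 ≤ B := by positivity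
    rw [Metric.cauchySeq_iff]
    intro ε hε
    obtain ⟨z, hz⟩ := hdense.exists_dist_lt x (ε := ε / (4 * (B + 1))) (by positivity)
    obtain ⟨N, hN⟩ := Metric.cauchySeq_iff.1 (hcauchyJ t ht z) (ε / 2) (by positivity)
    refine ⟨N, fun m hm n hn => ?_⟩
    rw [dist_eq_norm, lt_div_iff₀ (by positivity)] at hz
    have h1 : ∀ k, ‖expGroup (L k) t (x - J z)‖ ≤ B * ‖x - J z‖ := fun k =>
      (expGroup (L k) t).le_of_opNorm_le (hbound k t ht) _
    have h2 := hN m hm n hn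
    rw [dist_eq_norm] at h2 ⊢
    have e : expGroup (L m) t x - expGroup (L n) t x = expGroup (L m) t (x - J z) +
        (expGroup (L m) t (J z) - expGroup (L n) t (J z)) - expGroup (L n) t (x - J z) := by
      simp only [map_sub]; abel
    rw [e]
    have h3 := norm_sub_le (expGroup (L m) t (x - J z) +
        (expGroup (L m) t (J z) - expGroup (L n) t (J z))) (expGroup (L n) t (x - J z))
    have h4 := norm_add_le (expGroup (L m) t (x - J z))
        (expGroup (L m) t (J z) - expGroup (L n) t (J z))
    nlinarith [h1 m, h1 n, norm_nonneg (x - J z)]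
  have hex : ∀ t : ℝ≥0, ∃ S : X →L[ℝ] X, ∀ x,
      Tendsto (fun n => expGroup (L n) (t : ℝ) x) atTop (𝓝 (S x)) := by
    intro t
    choose f hf using fun x => cauchySeq_tendsto_of_complete (hcauchy t t.2 x)
    -- Banach–Steinhaus: a pointwise limit of bounded operators is bounded.
    exact ⟨continuousLinearMapOfTendsto (fun n => expGroup (L n) (t : ℝ))
      (tendsto_pi_nhds.2 hf), hf⟩
  choose S hS using hex
  have hSbound : ∀ (t : ℝ≥0) x, ‖S t x‖ ≤ M * Real.exp (ω * t) * ‖x‖ := fun t x =>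
    le_of_tendsto (hS t x).norm (Eventually.of_forall fun n =>
      (expGroup (L n) t).le_of_opNorm_le (hbound n t t.2) x)
  have hSJ : ∀ t x, J (S t x) = S t (J x) := by
    intro t x
    have h1 := (J.continuous.tendsto _).comp (hS t x)
    refine tendsto_nhds_unique h1 ?_
    simpa [Function.comp_def, hJE] using hS t (J x)
  have hunique : ∀ y : ℝ → X, Continuous y →
        (∀ t, 0 ≤ t → HasDerivWithinAt (fun s => J (y s)) (K (y t)) (Ici 0) t) →
        ∀ t : ℝ≥0, y t = S t (y 0) := by
    intro y hy hd t
    apply hinj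
    rw [hSJ]
    obtain ⟨D, hD⟩ := (isCompact_Icc (a := (0 : ℝ)) (b := t)).exists_bound_of_continuousOn
      hy.continuousOn
    have h1 : ∀ n, ‖J (y t) - expGroup (L n) t (J (y 0))‖ ≤
        M * Real.exp (ω * t) * (‖K - L n * J‖ * D) * t := fun n =>
      norm_sub_expGroup_le hd t.2 (fun s hs => hbound' n s t hs.1 hs.2) hD
    have h2 : Tendsto (fun n => M * Real.exp (ω * t) * (‖K - L n * J‖ * D) * t) atTop (𝓝 0) := by
      have h3 : Tendsto (fun n => ‖K - L n * J‖) atTop (𝓝 0) := by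
        simpa using (hlim.const_sub K).norm
      simpa using ((h3.mul_const D).const_mul (M * Real.exp (ω * t))).mul_const (t : ℝ)
    have h3 := squeeze_zero_norm h1 h2
    have h4 := (hS t (J (y 0))).const_sub (J (y t))
    exact sub_eq_zero.1 (tendsto_nhds_unique h4 h3)
  -- The derivative of `exp(u L n) J x` is `exp(u L n) (L n J) x`, bounded uniformly in `n`. The
  -- limit is therefore locally Lipschitz in time.
  have hcontJ : ∀ x, Continuous fun t : ℝ≥0 => S t (J x) := by
    intro x
    rw [continuous_iff_continuousAt]
    intro t
    obtain ⟨D, hD⟩ := hlim.norm.bddAbove_range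
    have hD' : ∀ n, ‖L n * J‖ ≤ D := fun n => hD ⟨n, rfl⟩
    have hD0 : 0 ≤ D := (norm_nonneg _).trans (hD' 0)
    set B := M * Real.exp (ω * (t + 1)) with hB
    have hB0 : 0 ≤ B := by positivity
    have hlip : ∀ r s : ℝ≥0, r ≤ s → s ≤ t + 1 →
        ‖S s (J x) - S r (J x)‖ ≤ B * (D * ‖x‖) * (s - r) := by
      intro r s hrs hst
      refine le_of_tendsto ((hS s (J x)).sub (hS r (J x))).norm (Eventually.of_forall fun n => ?_)
      refine norm_image_sub_le_of_norm_deriv_le_segment' (a := (r : ℝ)) (b := s)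
        (f := fun u => expGroup (L n) u (J x)) (f' := fun u => expGroup (L n) u ((L n * J) x))
        (fun u _ => ?_) (fun u hu => ?_) s ⟨by exact_mod_cast hrs, le_rfl⟩
      · have := (hasDerivAt_expGroup (L n) u).clm_apply (hasDerivAt_const u (J x))
        simpa using this.hasDerivWithinAt
      · have h1 : u ≤ t + 1 := hu.2.le.trans (by exact_mod_cast hst)
        refine ((expGroup (L n) u).le_of_opNorm_le (hbound' n u _ (r.2.trans hu.1) h1) _).trans ?_
        exact mul_le_mul_of_nonneg_left ((L n * J).le_of_opNorm_le (hD' n) x) hB0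
    have hlip' : ∀ s : ℝ≥0, s ≤ t + 1 →
        ‖S s (J x) - S t (J x)‖ ≤ B * (D * ‖x‖) * dist s t := by
      intro s hs
      rw [NNReal.dist_eq]
      rcases le_total t s with h | h
      · rw [abs_of_nonneg (sub_nonneg.2 (by exact_mod_cast h))]
        exact hlip t s h hs
      · rw [abs_sub_comm, abs_of_nonneg (sub_nonneg.2 (by exact_mod_cast h)), norm_sub_rev]
        exact hlip s t h (by simp)
    rw [ContinuousAt, tendsto_iff_norm_sub_tendsto_zero]
    have hev : ∀ᶠ s in 𝓝 t, s ≤ t + 1 := by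
      refine (eventually_lt_nhds (b := t + 1) ?_).mono fun s hs => hs.le
      exact lt_add_of_pos_right t zero_lt_one
    refine squeeze_zero' (Eventually.of_forall fun s => norm_nonneg _) (hev.mono hlip') ?_
    have : Tendsto (fun s => dist s t) (𝓝 t) (𝓝 0) := tendsto_iff_dist_tendsto_zero.1 tendsto_id
    simpa using this.const_mul (B * (D * ‖x‖))
  have hcont : ∀ x, Continuous fun t : ℝ≥0 => S t x := by
    intro x
    rw [continuous_iff_continuousAt]
    intro t
    set B := M * Real.exp (ω * (t + 1)) with hB
    have hB0 : 0 ≤ B := by positivity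
    have hSB : ∀ s : ℝ≥0, s ≤ t + 1 → ∀ x, ‖S s x‖ ≤ B * ‖x‖ := by
      intro s hs x
      refine (hSbound s x).trans ?_
      have : (s : ℝ) ≤ t + 1 := by exact_mod_cast hs
      rw [hB]
      gcongr
    have hev : ∀ᶠ s in 𝓝 t, s ≤ t + 1 := by
      refine (eventually_lt_nhds (b := t + 1) ?_).mono fun s hs => hs.le
      exact lt_add_of_pos_right t zero_lt_one
    rw [ContinuousAt, Metric.tendsto_nhds]
    intro ε hε
    obtain ⟨z, hz⟩ := hdense.exists_dist_lt x (ε := ε / (4 * (B + 1))) (by positivity)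
    rw [dist_eq_norm, lt_div_iff₀ (by positivity)] at hz
    filter_upwards [hev, Metric.tendsto_nhds.1 ((hcontJ z).tendsto t) (ε / 2) (by positivity)]
      with s hs h2
    rw [dist_eq_norm] at h2 ⊢
    have e : S s x - S t x = S s (x - J z) + (S s (J z) - S t (J z)) - S t (x - J z) := by
      simp only [map_sub]; abel
    rw [e]
    have h3 := norm_sub_le (S s (x - J z) + (S s (J z) - S t (J z))) (S t (x - J z))
    have h4 := norm_add_le (S s (x - J z)) (S s (J z) - S t (J z))
    nlinarith [hSB s hs (x - J z), hSB t (by simp) (x - J z), norm_nonneg (x - J z)]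
  have hKS : ∀ t x, Tendsto (fun n => (L n * J) (expGroup (L n) (t : ℝ≥0) x)) atTop
      (𝓝 (K (S t x))) := fun t x => 
    (isBoundedBilinearMap_apply.continuous.tendsto (K, S t x)).comp (hlim.prodMk_nhds (hS t x))
  -- The equation passes to the limit in integrated form, by dominated convergence.
  have hint : ∀ x (t : ℝ≥0),
      J (S t x) = J x + ∫ s in (0 : ℝ)..t, K (S s.toNNReal x) := by
    intro x t
    obtain ⟨D, hD⟩ := hlim.norm.bddAbove_range
    have hD' : ∀ n, ‖L n * J‖ ≤ D := fun n => hD ⟨n, rfl⟩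
    have hD0 : 0 ≤ D := (norm_nonneg _).trans (hD' 0)
    have hc : ∀ n, Continuous fun s => (L n * J) (expGroup (L n) s x) := fun n =>
      (L n * J).continuous.comp (continuous_expGroup_apply (L n) x)
    have h1 : ∀ n, J (expGroup (L n) t x) =
        J x + ∫ s in (0 : ℝ)..t, (L n * J) (expGroup (L n) s x) := by
      intro n
      rw [intervalIntegral.integral_eq_sub_of_hasDerivAt
        (f := fun s => J (expGroup (L n) s x)) (fun s _ => ?_) ((hc n).intervalIntegrable _ _)]
      · simp [expGroup_zero]
      · rw [← (hcomm n).eq]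
        exact J.hasFDerivAt.comp_hasDerivAt s (hasDerivAt_expGroup_apply (L n) x s)
    have h2 : Tendsto (fun n => ∫ s in (0 : ℝ)..t, (L n * J) (expGroup (L n) s x)) atTop
        (𝓝 (∫ s in (0 : ℝ)..t, K (S s.toNNReal x))) := by
      refine intervalIntegral.tendsto_integral_filter_of_dominated_convergence
        (fun _ => D * (M * Real.exp (ω * t) * ‖x‖))
        (Eventually.of_forall fun n => (hc n).aestronglyMeasurable)
        (Eventually.of_forall fun n => Eventually.of_forall fun s hs => ?_)
        intervalIntegrable_const (Eventually.of_forall fun s hs => ?_)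
      · rw [uIoc_of_le t.coe_nonneg] at hs
        refine (L n * J).le_of_opNorm_le_of_le (hD' n) ?_
        exact (expGroup (L n) s).le_of_opNorm_le (hbound' n s t hs.1.le hs.2) x
      · rw [uIoc_of_le t.coe_nonneg] at hs
        have := hKS s.toNNReal x
        rwa [Real.coe_toNNReal s hs.1.le] at this
    refine tendsto_nhds_unique ((J.continuous.tendsto _).comp (hS t x)) ?_
    simpa only [Function.comp_def, h1] using h2.const_add (J x)
  refine ⟨S, ⟨?_, ?_, hcont⟩, ?_, hunique⟩
  · ext x
    refine tendsto_nhds_unique (hS 0 x) ?_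
    simp [expGroup_zero]
  · intro s t
    ext x
    refine tendsto_nhds_unique (hS (s + t) x) ?_
    -- The uniform bound allows the inner factor of the product to be replaced by its limit.
    have h1 : Tendsto (fun n => expGroup (L n) (s : ℝ) (expGroup (L n) t x - S t x)) atTop
        (𝓝 0) := by
      refine squeeze_zero_norm (a := fun n => M * Real.exp (ω * s) * ‖expGroup (L n) t x - S t x‖)
        (fun n => (expGroup (L n) s).le_of_opNorm_le (hbound n s s.2) _) ?_
      simpa using (tendsto_iff_norm_sub_tendsto_zero.1 (hS t x)).const_mul (M * Real.exp (ω * s))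
    have h2 := h1.add (hS s (S t x))
    simpa [expGroup_add] using h2
  · intro x t ht
    have hg : Continuous fun s : ℝ => K (S s.toNNReal x) :=
      K.continuous.comp ((hcont x).comp continuous_real_toNNReal)
    have h1 := intervalIntegral.integral_hasDerivAt_right (hg.intervalIntegrable 0 t)
      (hg.stronglyMeasurableAtFilter _ _) hg.continuousAt
    refine HasDerivWithinAt.congr (h1.hasDerivWithinAt.const_add (J x)) ?_ ?_
    · intro s hs
      have := hint x s.toNNReal
      rwa [Real.coe_toNNReal s hs] at this
    · have := hint x t.toNNReal
      rwa [Real.coe_toNNReal t ht] at this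

end ApproximatingExponentials

/-! ### Bounded symmetric approximations of the inverse of a nonnegative operator. -/

section Resolvent

variable {H : Type*} [NormedAddCommGroup H] [InnerProductSpace ℝ H] [CompleteSpace H]

/-- The inverse of `T + ε` for a symmetric nonnegative operator `T`. -/
theorem exists_resolvent (T : H →L[ℝ] H) (hsymm : (T : H →ₗ[ℝ] H).IsSymmetric)
    (hpos : ∀ x, 0 ≤ inner ℝ (T x) x) {ε : ℝ} (hε : 0 < ε) :
    ∃ B : H →L[ℝ] H, (B : H →ₗ[ℝ] H).IsSymmetric ∧ Commute T B ∧
      ‖B * T ^ 2 - T‖ ≤ ε := by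
  -- Coercivity: `⟪(T + ε)x, x⟫ ≥ ε‖x‖²`.
  have hu : IsUnit (T + ε • (1 : H →L[ℝ] H)) := by
    refine ContinuousLinearMap.isUnit_of_forall_le_norm_inner_map _ (c := ⟨ε, hε.le⟩) hε ?_
    intro x
    refine le_trans ?_ (le_abs_self _)
    have : inner ℝ ((T + ε • (1 : H →L[ℝ] H)) x) x = inner ℝ (T x) x + ε * ‖x‖ ^ 2 := by
      simp [inner_add_left, inner_smul_left]
    rw [this]
    change ‖x‖ ^ 2 * ε ≤ _
    linarith [hpos x]
  obtain ⟨u, hu⟩ := hu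
  have hTu : Commute T (u : H →L[ℝ] H) := by
    rw [hu]
    exact (Commute.refl T).add_right ((Commute.one_right T).smul_right ε)
  have hTB : Commute T ((u⁻¹ : (H →L[ℝ] H)ˣ) : H →L[ℝ] H) := hTu.units_inv_right
  have huB : ∀ x, (u : H →L[ℝ] H) (((u⁻¹ : (H →L[ℝ] H)ˣ) : H →L[ℝ] H) x) = x := fun x =>
    DFunLike.congr_fun u.mul_inv x
  -- Expanding `‖T y + ε y‖²`, the cross term is nonnegative, so `‖T y‖ ≤ ‖(T + ε)y‖`.
  have hBT : ‖((u⁻¹ : (H →L[ℝ] H)ˣ) : H →L[ℝ] H) * T‖ ≤ 1 := by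
    rw [← hTB.eq]
    refine ContinuousLinearMap.opNorm_le_bound _ zero_le_one fun x => ?_
    rw [one_mul]
    set y := ((u⁻¹ : (H →L[ℝ] H)ˣ) : H →L[ℝ] H) x with hy
    have hxy : x = T y + ε • y := by
      rw [← huB x, ← hy, hu]; simp
    change ‖T y‖ ≤ ‖x‖
    apply le_of_sq_le_sq _ (norm_nonneg _)
    rw [hxy, norm_add_sq_real, inner_smul_right]
    nlinarith [mul_nonneg hε.le (hpos y), sq_nonneg ‖ε • y‖]
  refine ⟨((u⁻¹ : (H →L[ℝ] H)ˣ) : H →L[ℝ] H), ?_, hTB, ?_⟩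
  · have hus : ∀ a b, inner ℝ ((u : H →L[ℝ] H) a) b = inner ℝ a ((u : H →L[ℝ] H) b) := by
      intro a b
      have := hsymm a b
      simp only [ContinuousLinearMap.coe_coe] at this
      simp [hu, inner_add_left, inner_add_right, inner_smul_left, inner_smul_right, this]
    intro a b
    simp only [ContinuousLinearMap.coe_coe]
    conv_lhs => rw [← huB b, ← hus, huB]
  · have e : ((u⁻¹ : (H →L[ℝ] H)ˣ) : H →L[ℝ] H) * T ^ 2 - T =
        (-ε) • (((u⁻¹ : (H →L[ℝ] H)ˣ) : H →L[ℝ] H) * T) := by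
      have h1 : ((u⁻¹ : (H →L[ℝ] H)ˣ) : H →L[ℝ] H) * ((u : H →L[ℝ] H) * T) = T := by
        rw [← mul_assoc, u.inv_mul, one_mul]
      nth_rewrite 2 [← h1]
      rw [hu, add_mul, smul_mul_assoc, one_mul, mul_add, mul_smul_comm, pow_two, neg_smul]
      abel
    rw [e, norm_smul, norm_neg, Real.norm_of_nonneg hε.le]
    exact mul_le_of_le_one_right hε.le hBT

/-- Bounded symmetric approximations of the inverse of a symmetric nonnegative operator. -/
theorem exists_approximate_inverse (T : H →L[ℝ] H) (hsymm : (T : H →ₗ[ℝ] H).IsSymmetric)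
    (hpos : ∀ x, 0 ≤ inner ℝ (T x) x) :
    ∃ B : ℕ → H →L[ℝ] H, (∀ n, (B n : H →ₗ[ℝ] H).IsSymmetric) ∧ (∀ n, Commute T (B n)) ∧
      Tendsto (fun n => B n * T ^ 4) atTop (𝓝 (T ^ 3)) ∧
      Tendsto (fun n => B n ^ 2 * T ^ 4) atTop (𝓝 (T ^ 2)) := by
  choose B hs hc hB using fun n : ℕ =>
    exists_resolvent T hsymm hpos (ε := 1 / ((n : ℝ) + 1)) (by positivity)
  -- One extra factor `T` turns strong into norm convergence. The square of this limit is what calls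
  -- for `T ^ 4` in the smoothing.
  have h1 : Tendsto (fun n => B n * T ^ 2) atTop (𝓝 T) := by
    rw [tendsto_iff_norm_sub_tendsto_zero]
    exact squeeze_zero (fun n => norm_nonneg _) hB tendsto_one_div_add_atTop_nhds_zero_nat
  refine ⟨B, hs, hc, ?_, ?_⟩
  · have h2 := h1.mul_const (T ^ 2)
    have e : T * T ^ 2 = T ^ 3 := by rw [← pow_succ']
    rw [e] at h2
    refine h2.congr fun n => ?_
    rw [mul_assoc, ← pow_add]
  · refine (h1.pow 2).congr fun n => ?_
    rw [(((hc n).symm).pow_right 2).mul_pow, ← pow_mul]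

end Resolvent

/-! ### The isometry `A^{1/2} : H¹ → H` and its inverse. -/

namespace StrictlyPositiveOperator

variable {H : Type*} [NormedAddCommGroup H] [InnerProductSpace ℝ H] [CompleteSpace H]
variable (A : StrictlyPositiveOperator H)

theorem inner_h1 (u v : A.H1) : inner ℝ u v = inner ℝ (A.sqrtMap u) (A.sqrtMap v) := rfl

theorem norm_sqrtMap (u : A.H1) : ‖A.sqrtMap u‖ = ‖u‖ := by
  have h : ‖A.sqrtMap u‖ ^ 2 = ‖u‖ ^ 2 := by
    rw [← real_inner_self_eq_norm_sq, ← real_inner_self_eq_norm_sq, inner_h1]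
  exact (pow_left_inj₀ (norm_nonneg _) (norm_nonneg _) two_ne_zero).1 h

theorem mem_graph_sqrt_iff (x z : H) :
    (x, z) ∈ A.sqrt.graph ↔ ∃ u : A.H1, A.incl u = x ∧ A.sqrtMap u = z :=
  A.sqrt.mem_graph_iff

/-- `A` is onto and factors as `A^{1/2} A^{1/2}`. -/
theorem sqrtMap_surjective : Function.Surjective A.sqrtMap := by
  obtain ⟨c, hc, G, hG, -, -⟩ := A.exists_inverse
  intro y
  obtain ⟨z, -, hz⟩ := (A.isPositiveSqrt_sqrt.mem_graph_iff _ _).1 ((hG (G y) y).2 rfl)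
  obtain ⟨u, -, hu⟩ := (A.mem_graph_sqrt_iff _ _).1 hz
  exact ⟨u, hu⟩

/-- `A^{1/2}` as an isometry of `H¹` onto `H`. -/
noncomputable def sqrtIsometry : A.H1 ≃ₗᵢ[ℝ] H :=
  LinearIsometryEquiv.ofSurjective ⟨A.sqrtMap, A.norm_sqrtMap⟩ A.sqrtMap_surjective

theorem sqrtIsometry_apply (u : A.H1) : A.sqrtIsometry u = A.sqrtMap u := rfl

theorem inner_incl_sqrtMap (u v : A.H1) :
    inner ℝ (A.sqrtMap u) (A.incl v) = inner ℝ (A.incl u) (A.sqrtMap v) := by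
  have hs := A.isPositiveSqrt_sqrt.isSelfAdjoint
  have h1 : (A.incl u, A.sqrtMap u) ∈ A.sqrt.graph := (A.mem_graph_sqrt_iff _ _).2 ⟨u, rfl, rfl⟩
  have h2 : (A.incl v, A.sqrtMap v) ∈ A.sqrt.graph.adjoint := by
    rw [← LinearPMap.adjoint_graph_eq_graph_adjoint hs.dense_domain,
      LinearPMap.isSelfAdjoint_def.1 hs]
    exact (A.mem_graph_sqrt_iff _ _).2 ⟨v, rfl, rfl⟩
  exact sub_eq_zero.1 ((Submodule.mem_adjoint_iff _ _).1 h2 _ _ h1)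

theorem isSymmetric_incl_comp_symm :
    (A.incl ∘ₗ A.sqrtIsometry.symm.toLinearEquiv.toLinearMap).IsSymmetric := by
  intro x y
  obtain ⟨u, rfl⟩ := A.sqrtIsometry.surjective x
  obtain ⟨v, rfl⟩ := A.sqrtIsometry.surjective y
  simp only [LinearMap.comp_apply, LinearEquiv.coe_coe, LinearIsometryEquiv.coe_toLinearEquiv,
    LinearIsometryEquiv.symm_apply_apply]
  exact (A.inner_incl_sqrtMap u v).symm

/-- The bounded operator `A^{-1/2}`. -/
noncomputable def invSqrt : H →L[ℝ] H :=
  -- Hellinger–Toeplitz: an everywhere defined symmetric operator is bounded.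
  ⟨A.incl ∘ₗ A.sqrtIsometry.symm.toLinearEquiv.toLinearMap, A.isSymmetric_incl_comp_symm.continuous⟩

theorem invSqrt_sqrtMap (u : A.H1) : A.invSqrt (A.sqrtMap u) = A.incl u := by
  change A.incl (A.sqrtIsometry.symm (A.sqrtIsometry u)) = _
  simp

theorem isSymmetric_invSqrt : (A.invSqrt : H →ₗ[ℝ] H).IsSymmetric := A.isSymmetric_incl_comp_symm

theorem inner_invSqrt (x y : H) : inner ℝ (A.invSqrt x) y = inner ℝ x (A.invSqrt y) :=
  A.isSymmetric_invSqrt x y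

theorem inner_invSqrt_nonneg (x : H) : 0 ≤ inner ℝ (A.invSqrt x) x := by
  obtain ⟨u, rfl⟩ := A.sqrtMap_surjective x
  rw [invSqrt_sqrtMap, real_inner_comm]
  exact A.isPositiveSqrt_sqrt.nonneg u

theorem invSqrt_injective : Function.Injective A.invSqrt := by
  intro x y h
  obtain ⟨u, rfl⟩ := A.sqrtMap_surjective x
  obtain ⟨v, rfl⟩ := A.sqrtMap_surjective y
  rw [invSqrt_sqrtMap, invSqrt_sqrtMap] at h
  exact congrArg _ (Subtype.ext h)

theorem mem_graph_op_iff (x y : H) : (x, y) ∈ A.op.graph ↔ x = A.invSqrt (A.invSqrt y) := by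
  rw [A.isPositiveSqrt_sqrt.mem_graph_iff]
  constructor
  · rintro ⟨z, h1, h2⟩
    obtain ⟨u, rfl, rfl⟩ := (A.mem_graph_sqrt_iff _ _).1 h1
    obtain ⟨v, hv, rfl⟩ := (A.mem_graph_sqrt_iff _ _).1 h2
    rw [invSqrt_sqrtMap, hv, invSqrt_sqrtMap]
  · rintro rfl
    obtain ⟨v, rfl⟩ := A.sqrtMap_surjective y
    rw [invSqrt_sqrtMap]
    obtain ⟨u, hu⟩ := A.sqrtMap_surjective (A.incl v)
    refine ⟨A.incl v, ?_, (A.mem_graph_sqrt_iff _ _).2 ⟨v, rfl, rfl⟩⟩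
    refine (A.mem_graph_sqrt_iff _ _).2 ⟨u, ?_, hu⟩
    rw [← hu, invSqrt_sqrtMap]

theorem coe_eq_invSqrt_op (φ : A.op.domain) : (φ : H) = A.invSqrt (A.invSqrt (A.op φ)) :=
  (A.mem_graph_op_iff _ _).1 (A.op.mem_graph φ)

theorem exists_op_eq (y : H) : ∃ φ : A.op.domain, (φ : H) = A.invSqrt (A.invSqrt y) ∧ A.op φ = y :=
  A.op.mem_graph_iff.1 ((A.mem_graph_op_iff _ y).2 rfl)

end StrictlyPositiveOperator

/-! ### Operator matrices and the energy estimate. -/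

section BlockOperator

variable {H : Type*} [NormedAddCommGroup H]

/-- The energy functional for which the groups of `norm_expGroup_blockOperator_le` are
quasi-contractive. -/
noncomputable def blockEnergy (β : ℝ) (x : H × H × H × H) : ℝ :=
  ‖x.1‖ ^ 2 + β * ‖x.2.1‖ ^ 2 + ‖x.2.2.1‖ ^ 2 + ‖x.2.2.2‖ ^ 2

theorem sq_norm_le_blockEnergy {β : ℝ} (hβ : 0 < β) (x : H × H × H × H) :
    ‖x‖ ^ 2 ≤ (1 + β⁻¹) * blockEnergy β x := by
  obtain ⟨p, r, ζ, θ⟩ := x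
  have hr : ‖r‖ ^ 2 = β⁻¹ * (β * ‖r‖ ^ 2) := by field_simp
  have h0 : 0 ≤ β * ‖r‖ ^ 2 := by positivity
  have hb : 0 < β⁻¹ := by positivity
  simp only [blockEnergy, Prod.norm_mk]
  rcases max_cases ‖p‖ (max ‖r‖ (max ‖ζ‖ ‖θ‖)) with ⟨h, -⟩ | ⟨h, -⟩ <;> rw [h]
  · nlinarith [sq_nonneg ‖p‖, sq_nonneg ‖ζ‖, sq_nonneg ‖θ‖]
  rcases max_cases ‖r‖ (max ‖ζ‖ ‖θ‖) with ⟨h, -⟩ | ⟨h, -⟩ <;> rw [h]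
  · have : 0 ≤ β⁻¹ * (‖p‖ ^ 2 + ‖ζ‖ ^ 2 + ‖θ‖ ^ 2) := by positivity
    nlinarith [sq_nonneg ‖p‖, sq_nonneg ‖ζ‖, sq_nonneg ‖θ‖]
  rcases max_cases ‖ζ‖ ‖θ‖ with ⟨h, -⟩ | ⟨h, -⟩ <;> rw [h]
  · nlinarith [sq_nonneg ‖p‖, sq_nonneg ‖ζ‖, sq_nonneg ‖θ‖]
  · nlinarith [sq_nonneg ‖p‖, sq_nonneg ‖ζ‖, sq_nonneg ‖θ‖]

theorem blockEnergy_le {β : ℝ} (hβ : 0 < β) (x : H × H × H × H) :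
    blockEnergy β x ≤ (3 + β) * ‖x‖ ^ 2 := by
  have h1 : ‖x.1‖ ^ 2 ≤ ‖x‖ ^ 2 := by gcongr; exact norm_fst_le x
  have h2 : ‖x.2.1‖ ^ 2 ≤ ‖x‖ ^ 2 := by
    gcongr; exact (norm_fst_le _).trans (norm_snd_le x)
  have h3 : ‖x.2.2.1‖ ^ 2 ≤ ‖x‖ ^ 2 := by
    gcongr; exact (norm_fst_le _).trans ((norm_snd_le _).trans (norm_snd_le x))
  have h4 : ‖x.2.2.2‖ ^ 2 ≤ ‖x‖ ^ 2 := by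
    gcongr; exact (norm_snd_le _).trans ((norm_snd_le _).trans (norm_snd_le x))
  rw [blockEnergy]
  nlinarith

variable [InnerProductSpace ℝ H]

/-- The `4 × 4` operator matrix sending `(p, r, ζ, θ)` to
`(P (r - δ p), Q ζ + a P (r - δ p), -β Q r + η R θ, -κ R θ - η R ζ)`. -/
noncomputable def blockOperator (δ a β κ η : ℝ) (P Q R : H →L[ℝ] H) :
    (H × H × H × H) →L[ℝ] (H × H × H × H) :=
  let p : (H × H × H × H) →L[ℝ] H := .fst ℝ H (H × H × H)
  let t : (H × H × H × H) →L[ℝ] (H × H × H) := .snd ℝ H (H × H × H)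
  let r : (H × H × H × H) →L[ℝ] H := (ContinuousLinearMap.fst ℝ H (H × H)).comp t
  let ζ : (H × H × H × H) →L[ℝ] H :=
    ((ContinuousLinearMap.fst ℝ H H).comp (.snd ℝ H (H × H))).comp t
  let θ : (H × H × H × H) →L[ℝ] H :=
    ((ContinuousLinearMap.snd ℝ H H).comp (.snd ℝ H (H × H))).comp t
  (P.comp (r - δ • p)).prod ((Q.comp ζ + a • P.comp (r - δ • p)).prod
    ((-(β • Q.comp r) + η • R.comp θ).prod (-(κ • R.comp θ) - η • R.comp ζ)))

@[simp]
theorem blockOperator_apply (δ a β κ η : ℝ) (P Q R : H →L[ℝ] H) (p r ζ θ : H) :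
    blockOperator δ a β κ η P Q R (p, r, ζ, θ) =
      (P (r - δ • p), Q ζ + a • P (r - δ • p), -(β • Q r) + η • R θ, -(κ • R θ) - η • R ζ) := by
  simp [blockOperator]

/-- The diagonal operator with all four entries equal to `C`. -/
noncomputable def diagOperator (C : H →L[ℝ] H) : (H × H × H × H) →L[ℝ] (H × H × H × H) :=
  C.prodMap (C.prodMap (C.prodMap C))

@[simp]
theorem diagOperator_apply (C : H →L[ℝ] H) (p r ζ θ : H) :
    diagOperator C (p, r, ζ, θ) = (C p, C r, C ζ, C θ) := rfl

theorem blockOperator_mul_diagOperator (δ a β κ η : ℝ) (P Q R C : H →L[ℝ] H) :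
    blockOperator δ a β κ η P Q R * diagOperator C =
      blockOperator δ a β κ η (P * C) (Q * C) (R * C) := by
  refine ContinuousLinearMap.ext fun ⟨p, r, ζ, θ⟩ => ?_
  simp

theorem diagOperator_mul_blockOperator (δ a β κ η : ℝ) (P Q R C : H →L[ℝ] H) :
    diagOperator C * blockOperator δ a β κ η P Q R =
      blockOperator δ a β κ η (C * P) (C * Q) (C * R) := by
  refine ContinuousLinearMap.ext fun ⟨p, r, ζ, θ⟩ => ?_
  simp

theorem commute_diagOperator_blockOperator (δ a β κ η : ℝ) {P Q R C : H →L[ℝ] H}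
    (hP : Commute C P) (hQ : Commute C Q) (hR : Commute C R) :
    Commute (diagOperator C) (blockOperator δ a β κ η P Q R) := by
  rw [Commute, SemiconjBy, blockOperator_mul_diagOperator, diagOperator_mul_blockOperator,
    hP.eq, hQ.eq, hR.eq]

theorem tendsto_blockOperator {ι : Type*} {l : Filter ι} (δ a β κ η : ℝ)
    {P Q R : ι → H →L[ℝ] H} {P' Q' R' : H →L[ℝ] H} (hP : Tendsto P l (𝓝 P'))
    (hQ : Tendsto Q l (𝓝 Q')) (hR : Tendsto R l (𝓝 R')) :
    Tendsto (fun n => blockOperator δ a β κ η (P n) (Q n) (R n)) l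
      (𝓝 (blockOperator δ a β κ η P' Q' R')) := by
  have hprod : ∀ {E F G : Type _} [NormedAddCommGroup E] [NormedSpace ℝ E]
      [NormedAddCommGroup F] [NormedSpace ℝ F] [NormedAddCommGroup G] [NormedSpace ℝ G]
      {f : ι → E →L[ℝ] F} {g : ι → E →L[ℝ] G} {f' : E →L[ℝ] F} {g' : E →L[ℝ] G},
      Tendsto f l (𝓝 f') → Tendsto g l (𝓝 g') →
      Tendsto (fun n => (f n).prod (g n)) l (𝓝 (f'.prod g')) := by
    intro E F G _ _ _ _ _ _ f g f' g' hf hg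
    exact ((ContinuousLinearMap.prodₗᵢ (𝕜 := ℝ) ℝ).continuous.tendsto (f', g')).comp
      (hf.prodMk_nhds hg)
  have hcomp : ∀ {U : ι → H →L[ℝ] H} {U' : H →L[ℝ] H} (V : (H × H × H × H) →L[ℝ] H),
      Tendsto U l (𝓝 U') → Tendsto (fun n => (U n).comp V) l (𝓝 (U'.comp V)) := fun V hU =>
    ((((ContinuousLinearMap.compL ℝ (H × H × H × H) H H).flip V).continuous.tendsto _).comp hU)
  refine hprod ?_ (hprod ?_ (hprod ?_ ?_))
  · exact hcomp _ hP
  · exact (hcomp _ hQ).add ((hcomp _ hP).const_smul a)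
  · exact ((hcomp _ hQ).const_smul β).neg.add
      ((hcomp _ hR).const_smul η)
  · exact ((hcomp _ hR).const_smul κ).neg.sub
      ((hcomp _ hR).const_smul η)

theorem injective_diagOperator {C : H →L[ℝ] H} (hC : Function.Injective C) :
    Function.Injective (diagOperator C) :=
  hC.prodMap (hC.prodMap (hC.prodMap hC))

theorem denseRange_diagOperator {C : H →L[ℝ] H} (hC : DenseRange C) :
    DenseRange (diagOperator C) :=
  hC.prodMap (hC.prodMap (hC.prodMap hC))

/-- The orthogonal complement of the range of a symmetric operator is its kernel. -/
theorem denseRange_of_isSymmetric_of_injective [CompleteSpace H] {T : H →L[ℝ] H}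
    (hT : (T : H →ₗ[ℝ] H).IsSymmetric) (hinj : Function.Injective T) : DenseRange T := by
  have h : Dense ((T : H →ₗ[ℝ] H).range : Set H) := by
    rw [Submodule.dense_iff_topologicalClosure_eq_top, Submodule.topologicalClosure_eq_top_iff,
      Submodule.eq_bot_iff]
    intro y hy
    apply hinj
    rw [map_zero]
    have h1 : inner ℝ (T (T y)) y = 0 := hy (T (T y)) ⟨T y, rfl⟩
    rw [show inner ℝ (T (T y)) y = inner ℝ (T y) (T y) from hT (T y) y] at h1
    exact inner_self_eq_zero.1 h1
  exact h

/-- The left side is the derivative of the energy along the flow. By symmetry of `B`, the pairs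
`±2β⟪ζ, B r⟫` and `±2η⟪ζ, B²θ⟫` cancel, and `B` remains only in `-2κ‖B θ‖² ≤ 0`. Hence the constant
does not depend on `B`. -/
theorem inner_blockOperator_le (δ a η : ℝ) {β κ : ℝ} (hβ : 0 < β) (hκ : 0 < κ)
    {B : H →L[ℝ] H} (hB : (B : H →ₗ[ℝ] H).IsSymmetric) (p r ζ θ : H) :
    2 * inner ℝ p (r - δ • p) + β * (2 * inner ℝ r (B ζ + a • (r - δ • p))) +
      2 * inner ℝ ζ (-(β • B r) + η • (B ^ 2) θ) +
      2 * inner ℝ θ (-(κ • (B ^ 2) θ) - η • (B ^ 2) ζ) ≤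
    ((1 + |β * a * δ|) * (1 + β⁻¹) + 2 * |a| + 2 * |δ|) * blockEnergy β (p, r, ζ, θ) := by
  have hs : ∀ x y, inner ℝ (B x) y = inner ℝ x (B y) := hB
  have hsq : ∀ x, (B ^ 2) x = B (B x) := fun x => by rw [pow_two]; rfl
  have e1 : inner ℝ r (B ζ) = inner ℝ ζ (B r) := by rw [← hs, real_inner_comm]
  have e2 : inner ℝ θ (B (B ζ)) = inner ℝ ζ (B (B θ)) := by
    rw [← hs, ← hs, real_inner_comm]
  have e3 : inner ℝ θ (B (B θ)) = ‖B θ‖ ^ 2 := by rw [← hs, real_inner_self_eq_norm_sq]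
  have e4 : inner ℝ r p = inner ℝ p r := real_inner_comm _ _
  simp only [hsq, inner_add_right, inner_sub_right, inner_neg_right, inner_smul_right,
    real_inner_self_eq_norm_sq, e1, e2, e3, e4, blockEnergy]
  have hpr : |inner ℝ p r| ≤ (‖p‖ ^ 2 + ‖r‖ ^ 2) / 2 := by
    refine (abs_real_inner_le_norm p r).trans ?_
    nlinarith [sq_nonneg (‖p‖ - ‖r‖)]
  have h1 : (1 - β * a * δ) * inner ℝ p r ≤ (1 + |β * a * δ|) * ((‖p‖ ^ 2 + ‖r‖ ^ 2) / 2) := by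
    refine (le_abs_self _).trans ?_
    rw [abs_mul]
    refine mul_le_mul ?_ hpr (abs_nonneg _) (by positivity)
    exact (abs_sub _ _).trans (by simp)
  have hr : ‖r‖ ^ 2 = β⁻¹ * (β * ‖r‖ ^ 2) := by field_simp
  have h0 : 0 ≤ β * ‖r‖ ^ 2 := by positivity
  have hb : 0 < β⁻¹ := by positivity
  set c := 1 + |β * a * δ| with hc
  have hc0 : 0 < c := by positivity
  have h2 : c * (‖p‖ ^ 2 + ‖r‖ ^ 2) ≤
      c * ((1 + β⁻¹) * (‖p‖ ^ 2 + β * ‖r‖ ^ 2 + ‖ζ‖ ^ 2 + ‖θ‖ ^ 2)) := by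
    refine mul_le_mul_of_nonneg_left ?_ hc0.le
    have : 0 ≤ β⁻¹ * (‖p‖ ^ 2 + ‖ζ‖ ^ 2 + ‖θ‖ ^ 2) := by positivity
    nlinarith [sq_nonneg ‖ζ‖, sq_nonneg ‖θ‖]
  have h3 : a * (β * ‖r‖ ^ 2) ≤ |a| * (‖p‖ ^ 2 + β * ‖r‖ ^ 2 + ‖ζ‖ ^ 2 + ‖θ‖ ^ 2) := by
    refine mul_le_mul (le_abs_self a) ?_ h0 (abs_nonneg _)
    nlinarith [sq_nonneg ‖p‖, sq_nonneg ‖ζ‖, sq_nonneg ‖θ‖]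
  have h4 : -δ * ‖p‖ ^ 2 ≤ |δ| * (‖p‖ ^ 2 + β * ‖r‖ ^ 2 + ‖ζ‖ ^ 2 + ‖θ‖ ^ 2) := by
    refine mul_le_mul (neg_le_abs δ) ?_ (sq_nonneg _) (abs_nonneg _)
    nlinarith [sq_nonneg ‖ζ‖, sq_nonneg ‖θ‖]
  have h5 : 0 ≤ κ * ‖B θ‖ ^ 2 := by positivity
  linarith

/-- The bound is uniform in `B`. -/
theorem norm_expGroup_blockOperator_le [CompleteSpace H] (δ a η : ℝ) {β κ : ℝ} (hβ : 0 < β)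
    (hκ : 0 < κ) : ∃ M ω : ℝ, 0 ≤ ω ∧ ∀ B : H →L[ℝ] H, (B : H →ₗ[ℝ] H).IsSymmetric →
      ∀ t, 0 ≤ t → ‖expGroup (blockOperator δ a β κ η 1 B (B ^ 2)) t‖ ≤ M * Real.exp (ω * t) := by
  set c := (1 + |β * a * δ|) * (1 + β⁻¹) + 2 * |a| + 2 * |δ| with hc
  have hc0 : 0 ≤ c := by positivity
  -- The energy is quadratic in the norm: the rate `c` is halved, and the product of the two
  -- equivalence constants appears under a root.
  refine ⟨√((1 + β⁻¹) * (3 + β)), c / 2, by positivity, fun B hB t ht => ?_⟩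
  refine ContinuousLinearMap.opNorm_le_bound _ (by positivity) fun x₀ => ?_
  set L := blockOperator δ a β κ η 1 B (B ^ 2) with hL
  set x : ℝ → H × H × H × H := fun s => expGroup L s x₀ with hx
  have hd : ∀ s, HasDerivAt x (L (x s)) s := hasDerivAt_expGroup_apply L x₀
  have hE : ∀ s, ∃ d, HasDerivAt (fun s => blockEnergy β (x s)) d s ∧
      d ≤ c * blockEnergy β (x s) := by
    intro s
    obtain ⟨h1, h'⟩ := (hd s).hasDerivWithinAt (s := univ).components
    obtain ⟨h2, h'⟩ := h'.components
    obtain ⟨h3, h4⟩ := h'.components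
    rw [hasDerivWithinAt_univ] at h1 h2 h3 h4
    refine ⟨_, ((h1.norm_sq.add (h2.norm_sq.const_mul β)).add h3.norm_sq).add h4.norm_sq, ?_⟩
    have := inner_blockOperator_le δ a η hβ hκ hB (x s).1 (x s).2.1 (x s).2.2.1 (x s).2.2.2
    rw [← hc] at this
    have e : L (x s) = L ((x s).1, (x s).2.1, (x s).2.2.1, (x s).2.2.2) := rfl
    rw [e, hL, blockOperator_apply]
    exact this
  -- Grönwall's argument.
  have hanti : Antitone fun s => Real.exp (-c * s) * blockEnergy β (x s) := by
    have hD : ∀ s, ∃ d, HasDerivAt (fun s => Real.exp (-c * s) * blockEnergy β (x s)) d s ∧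
        d ≤ 0 := by
      intro s
      obtain ⟨d, hd1, hd2⟩ := hE s
      refine ⟨_, (((hasDerivAt_id s).const_mul (-c)).exp).mul hd1, ?_⟩
      simp only [id]
      nlinarith [Real.exp_pos (-c * s), mul_le_mul_of_nonneg_left hd2 (Real.exp_pos (-c * s)).le]
    refine antitone_of_deriv_nonpos (fun s => ?_) fun s => ?_
    · obtain ⟨d, h, -⟩ := hD s
      exact h.differentiableAt
    · obtain ⟨d, h, h'⟩ := hD s
      rwa [h.deriv]
  have h1 := hanti ht
  simp only [mul_zero, Real.exp_zero, one_mul] at h1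
  have hx0 : x 0 = x₀ := by simp [hx, expGroup_zero]
  rw [hx0, neg_mul, Real.exp_neg, inv_mul_le_iff₀ (Real.exp_pos _)] at h1
  have h2 : ‖x t‖ ^ 2 ≤ (√((1 + β⁻¹) * (3 + β)) * Real.exp (c / 2 * t) * ‖x₀‖) ^ 2 := by
    rw [mul_pow, mul_pow, Real.sq_sqrt (by positivity), ← Real.exp_nat_mul]
    have e : ((2 : ℕ) : ℝ) * (c / 2 * t) = c * t := by push_cast; ring
    rw [e]
    calc ‖x t‖ ^ 2 ≤ (1 + β⁻¹) * blockEnergy β (x t) := sq_norm_le_blockEnergy hβ _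
      _ ≤ (1 + β⁻¹) * (Real.exp (c * t) * ((3 + β) * ‖x₀‖ ^ 2)) := by
        gcongr
        exact h1.trans (by gcongr; exact blockEnergy_le hβ x₀)
      _ = _ := by ring
  exact le_of_sq_le_sq h2 (by positivity)

end BlockOperator

/-! ### Equivalence of the smoothed system with one matrix equation. -/

section System

variable {H : Type*} [NormedAddCommGroup H] [InnerProductSpace ℝ H] [CompleteSpace H]

/-- The equations of the system, smoothed by the powers of an injective operator `T` which make
sense of each of them, are equivalent to a single equation for an operator matrix in the variables
`(p, q + δ p, w + α T q, θ)`. -/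
theorem hasDerivWithinAt_system_iff {T : H →L[ℝ] H} (hT : Function.Injective T)
    {α β γ δ κ η : ℝ} (hδ : β * δ = γ) {p q w θ : ℝ → H} (hq : Continuous q)
    (hp : Continuous p) (hw : Continuous w) (hθ : Continuous θ) :
    (∀ t, 0 ≤ t →
      HasDerivWithinAt (fun s => T (p s)) (T (q t)) (Ici 0) t ∧
      HasDerivWithinAt (fun s => T (q s)) (w t) (Ici 0) t ∧
      HasDerivWithinAt (fun s => T (T (w s)))
        (-α • T (T (w t)) - β • T (q t) - γ • T (p t) + η • θ t) (Ici 0) t ∧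
      HasDerivWithinAt (fun s => T (T (θ s)))
        (-κ • θ t - η • w t - (α * η) • T (q t)) (Ici 0) t) ↔
    ∀ t, 0 ≤ t → HasDerivWithinAt
      (fun s => diagOperator (T ^ 4) (p s, q s + δ • p s, w s + α • T (q s), θ s))
      (blockOperator δ (δ - α) β κ η (T ^ 4) (T ^ 3) (T ^ 2)
        (p t, q t + δ • p t, w t + α • T (q t), θ t)) (Ici 0) t := by
  have e2 : ∀ x, (T ^ 2) x = T (T x) := fun x => by simp [pow_succ]
  have e3 : ∀ x, (T ^ 3) x = T (T (T x)) := fun x => by simp [pow_succ]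
  have e4 : ∀ x, (T ^ 4) x = T (T (T (T x))) := fun x => by simp [pow_succ]
  have i2 : Function.Injective ⇑(T ^ 2) := fun x y h => by
    rw [e2, e2] at h; exact hT (hT h)
  have i3 : Function.Injective ⇑(T ^ 3) := fun x y h => by
    rw [e3, e3] at h; exact hT (hT (hT h))
  subst hδ
  constructor
  · intro h t ht
    obtain ⟨h1, h2, h3, h4⟩ := h t ht
    -- The first two equations already carry one factor `T` and the last two carry two; these powers
    -- bring all of them to `T ^ 4`.
    have h1' := (T ^ 3).comp_hasDerivWithinAt h1
    have h2' := (T ^ 3).comp_hasDerivWithinAt h2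
    have h3' := (T ^ 2).comp_hasDerivWithinAt h3
    have h4' := (T ^ 2).comp_hasDerivWithinAt h4
    -- This handles the summand `α T q` of the third coordinate, which carries one more `T`.
    have h5' := T.comp_hasDerivWithinAt h2'
    simp only [e2, e3] at h1' h2' h3' h4' h5'
    simp only [diagOperator_apply, blockOperator_apply, e2, e3, e4, map_add, map_sub, map_smul]
    refine (h1'.congr_deriv ?_).prodMk (((h2'.add (h1'.const_smul δ)).congr_deriv ?_).prodMk
      (((h3'.add (h5'.const_smul α)).congr_deriv ?_).prodMk (h4'.congr_deriv ?_)))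
    · module
    · module
    all_goals
      simp only [map_add, map_sub, map_smul]
      module
  · intro h
    -- Conversely, the coordinates are unmixed in order, and each surplus power of `T` is removed by
    -- injectivity and continuity of the right-hand side.
    have hP : ∀ t, 0 ≤ t → HasDerivWithinAt (fun s => T (p s)) (T (q t)) (Ici 0) t := by
      intro t ht
      refine hasDerivWithinAt_of_injective (T ^ 3) i3 (f := fun s => T (p s))
        (g := fun s => T (q s)) (by fun_prop) (fun t ht => ?_) ht
      have h1 := (h t ht).components.1
      simp only [diagOperator_apply, blockOperator_apply, e4, add_sub_cancel_right] at h1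
      simpa only [e3] using h1
    have hQ : ∀ t, 0 ≤ t → HasDerivWithinAt (fun s => T (q s)) (w t) (Ici 0) t := by
      intro t ht
      refine hasDerivWithinAt_of_injective (T ^ 3) i3 (f := fun s => T (q s)) hw
        (fun t ht => ?_) ht
      have h1 := (h t ht).components.1
      have h2 := (h t ht).components.2.components.1
      simp only [diagOperator_apply, blockOperator_apply, e4, e3, map_add, map_sub,
        map_smul] at h1 h2
      simp only [e3]
      refine ((h2.sub (h1.const_smul δ)).congr_deriv ?_).congr_of_eventuallyEq
        (Eventually.of_forall fun s => ?_) ?_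
      · module
      all_goals simp
    refine fun t ht => ⟨hP t ht, hQ t ht, ?_, ?_⟩
    · refine hasDerivWithinAt_of_injective (T ^ 2) i2 (f := fun s => T (T (w s)))
        (g := fun t => -α • T (T (w t)) - β • T (q t) - (β * δ) • T (p t) + η • θ t)
        (by fun_prop) (fun t ht => ?_) ht
      have h2 := (T ^ 4).comp_hasDerivWithinAt (hQ t ht)
      have h3 := (h t ht).components.2.components.2.components.1
      simp only [diagOperator_apply, blockOperator_apply, e4, e3, e2, map_add, map_sub,
        map_smul] at h2 h3
      simp only [e2]
      refine ((h3.sub (h2.const_smul α)).congr_deriv ?_).congr_of_eventuallyEq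
        (Eventually.of_forall fun s => ?_) ?_
      · simp only [map_add, map_sub, map_smul]
        module
      all_goals simp
    · refine hasDerivWithinAt_of_injective (T ^ 2) i2 (f := fun s => T (T (θ s)))
        (g := fun t => -κ • θ t - η • w t - (α * η) • T (q t))
        (by fun_prop) (fun t ht => ?_) ht
      have h4 := (h t ht).components.2.components.2.components.2
      simp only [diagOperator_apply, blockOperator_apply, e4, e3, e2] at h4
      simp only [e2]
      refine h4.congr_deriv ?_
      simp only [map_add, map_sub, map_smul]
      module

end System

/-! ### Weak solutions in the new coordinates. -/

namespace StrictlyPositiveOperator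

variable {H : Type*} [NormedAddCommGroup H] [InnerProductSpace ℝ H] [CompleteSpace H]
variable (A : StrictlyPositiveOperator H)

theorem continuous_sqrtMap : Continuous A.sqrtMap := A.sqrtIsometry.continuous

theorem continuous_incl : Continuous A.incl := by
  have : (A.incl : A.H1 → H) = fun u => A.invSqrt (A.sqrtMap u) :=
    funext fun u => (A.invSqrt_sqrtMap u).symm
  rw [this]
  exact A.invSqrt.continuous.comp A.continuous_sqrtMap

/-- The coordinates `(A^{1/2} u, A^{1/2} v + δ A^{1/2} u, w + α v, θ)` on the phase space. -/
noncomputable def coordinates (α δ : ℝ) : A.PhaseSpace ≃L[ℝ] H × H × H × H where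
  toFun x := (A.sqrtMap x.1, A.sqrtMap x.2.1 + δ • A.sqrtMap x.1,
    x.2.2.1 + α • A.invSqrt (A.sqrtMap x.2.1), x.2.2.2)
  invFun y := (A.sqrtIsometry.symm y.1, A.sqrtIsometry.symm (y.2.1 - δ • y.1),
    y.2.2.1 - α • A.invSqrt (y.2.1 - δ • y.1), y.2.2.2)
  map_add' x y := by
    simp only [Prod.fst_add, Prod.snd_add, map_add, Prod.mk_add_mk, smul_add, Prod.mk.injEq,
      true_and, and_true]
    constructor <;> abel
  map_smul' c x := by
    simp only [Prod.smul_fst, Prod.smul_snd, map_smul, RingHom.id_apply, Prod.smul_mk, smul_add,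
      smul_comm c]
  left_inv x := by
    simp [← sqrtIsometry_apply]
  right_inv y := by
    simp [← sqrtIsometry_apply]
  continuous_toFun := by
    have := A.continuous_sqrtMap
    fun_prop
  continuous_invFun := by
    fun_prop

/-- As `D(A)` is the range of `T²`, a test function is `φ = T²y` with `A φ = y` arbitrary. Symmetry
moves `T²` onto the solution, and the vectors `y` separate points. -/
theorem isWeakSolution_iff_invSqrt {α β γ κ η : ℝ} {z : A.PhaseSpace}
    {U : C(ℝ≥0, A.PhaseSpace)} :
    A.IsWeakSolution α β γ κ η z U ↔ U 0 = z ∧ ∀ t : ℝ, 0 ≤ t →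
      HasDerivWithinAt (fun s => A.invSqrt (A.sqrtMap (U s.toNNReal).1))
        (A.invSqrt (A.sqrtMap (U t.toNNReal).2.1)) (Ici 0) t ∧
      HasDerivWithinAt (fun s => A.invSqrt (A.sqrtMap (U s.toNNReal).2.1))
        (U t.toNNReal).2.2.1 (Ici 0) t ∧
      HasDerivWithinAt (fun s => A.invSqrt (A.invSqrt (U s.toNNReal).2.2.1))
        (-α • A.invSqrt (A.invSqrt (U t.toNNReal).2.2.1)
          - β • A.invSqrt (A.sqrtMap (U t.toNNReal).2.1)
          - γ • A.invSqrt (A.sqrtMap (U t.toNNReal).1) + η • (U t.toNNReal).2.2.2) (Ici 0) t ∧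
      HasDerivWithinAt (fun s => A.invSqrt (A.invSqrt (U s.toNNReal).2.2.2))
        (-κ • (U t.toNNReal).2.2.2 - η • (U t.toNNReal).2.2.1
          - (α * η) • A.invSqrt (A.sqrtMap (U t.toNNReal).2.1)) (Ici 0) t := by
  have hUc : Continuous fun s : ℝ => U s.toNNReal := U.continuous.comp continuous_real_toNNReal
  have hsep : ∀ x : H, (∀ y, innerSL ℝ y x = 0) → x = 0 := fun x hx =>
    inner_self_eq_zero.1 (hx x)
  have hi := A.continuous_incl
  simp only [invSqrt_sqrtMap]
  constructor
  · intro h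
    refine ⟨h.initial, fun t ht => ⟨?_, ?_, ?_, ?_⟩⟩
    · simpa [Real.coe_toNNReal t ht] using h.deriv_u t.toNNReal
    · simpa [Real.coe_toNNReal t ht] using h.deriv_v t.toNNReal
    · refine hasDerivWithinAt_of_separating (innerSL ℝ) hsep
        (f := fun s : ℝ => A.invSqrt (A.invSqrt (U s.toNNReal).2.2.1))
        (g := fun t : ℝ => -α • A.invSqrt (A.invSqrt (U t.toNNReal).2.2.1)
          - β • A.incl (U t.toNNReal).2.1 - γ • A.incl (U t.toNNReal).1
          + η • (U t.toNNReal).2.2.2) (by fun_prop) (fun y t ht => ?_) ht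
      obtain ⟨φ, hφ, hφ'⟩ := A.exists_op_eq y
      have h1 := h.deriv_w φ t.toNNReal
      rw [Real.coe_toNNReal t ht, hφ, hφ'] at h1
      simp only [innerSL_apply_apply, inner_add_left, inner_sub_left, real_inner_smul_left,
        real_inner_comm _ y, inner_invSqrt]
      exact h1
    · refine hasDerivWithinAt_of_separating (innerSL ℝ) hsep
        (f := fun s : ℝ => A.invSqrt (A.invSqrt (U s.toNNReal).2.2.2))
        (g := fun t : ℝ => -κ • (U t.toNNReal).2.2.2 - η • (U t.toNNReal).2.2.1
          - (α * η) • A.incl (U t.toNNReal).2.1) (by fun_prop) (fun y t ht => ?_) ht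
      obtain ⟨φ, hφ, hφ'⟩ := A.exists_op_eq y
      have h1 := h.deriv_θ φ t.toNNReal
      rw [Real.coe_toNNReal t ht, hφ, hφ'] at h1
      simp only [innerSL_apply_apply, inner_sub_left, real_inner_smul_left,
        real_inner_comm _ y, inner_invSqrt]
      exact h1
  · rintro ⟨h0, h⟩
    refine ⟨h0, fun t => ?_, fun t => ?_, fun φ t => ?_, fun φ t => ?_⟩
    · simpa using (h t t.2).1
    · simpa using (h t t.2).2.1
    · have h1 := (innerSL ℝ (A.op φ)).comp_hasDerivWithinAt (h t t.2).2.2.1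
      simp only [innerSL_apply_apply, inner_add_left, inner_sub_left, real_inner_smul_left,
        real_inner_comm _ (A.op φ), inner_invSqrt, ← A.coe_eq_invSqrt_op φ, Real.toNNReal_coe] at h1
      exact h1
    · have h1 := (innerSL ℝ (A.op φ)).comp_hasDerivWithinAt (h t t.2).2.2.2
      simp only [innerSL_apply_apply, inner_sub_left, real_inner_smul_left,
        real_inner_comm _ (A.op φ), inner_invSqrt, ← A.coe_eq_invSqrt_op φ, Real.toNNReal_coe] at h1
      exact h1

theorem isWeakSolution_iff_coordinates {α β γ δ κ η : ℝ} (hδ : β * δ = γ) {z : A.PhaseSpace}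
    {U : C(ℝ≥0, A.PhaseSpace)} :
    A.IsWeakSolution α β γ κ η z U ↔ U 0 = z ∧ ∀ t : ℝ, 0 ≤ t → HasDerivWithinAt
      (fun s => diagOperator (A.invSqrt ^ 4) (A.coordinates α δ (U s.toNNReal)))
      (blockOperator δ (δ - α) β κ η (A.invSqrt ^ 4) (A.invSqrt ^ 3) (A.invSqrt ^ 2)
        (A.coordinates α δ (U t.toNNReal))) (Ici 0) t := by
  have hUc : Continuous fun s : ℝ => U s.toNNReal := U.continuous.comp continuous_real_toNNReal
  have hs := A.continuous_sqrtMap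
  rw [isWeakSolution_iff_invSqrt]
  refine and_congr_right fun _ => ?_
  exact hasDerivWithinAt_system_iff A.invSqrt_injective hδ
    (p := fun s => A.sqrtMap (U s.toNNReal).1) (q := fun s => A.sqrtMap (U s.toNNReal).2.1)
    (w := fun s => (U s.toNNReal).2.2.1) (θ := fun s => (U s.toNNReal).2.2.2)
    (by fun_prop) (by fun_prop) (by fun_prop) (by fun_prop)

end StrictlyPositiveOperator

/-! ### Existence, uniqueness and the semigroup. -/

theorem theorem4p2 {H : Type*} [NormedAddCommGroup H] [InnerProductSpace ℝ H] [CompleteSpace H]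
    (A : StrictlyPositiveOperator H) {α β γ κ : ℝ} (hα : 0 < α) (hβ : 0 < β) (hγ : 0 < γ)
    (hκ : 0 < κ) (η : ℝ) :
    (∀ z : A.PhaseSpace, ∃! U : C(ℝ≥0, A.PhaseSpace), A.IsWeakSolution α β γ κ η z U) ∧
    ∃ S : ℝ≥0 → A.PhaseSpace →L[ℝ] A.PhaseSpace,
      IsStronglyContinuousSemigroup S ∧
      ∀ (z : A.PhaseSpace) (U : C(ℝ≥0, A.PhaseSpace)), A.IsWeakSolution α β γ κ η z U →
        ∀ t : ℝ≥0, U t = S t z := by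
  -- With this `δ`, `βAv + γAu = βA(v + δu)`, so only `r` enters the elastic term.
  have hδ : β * (γ / β) = γ := mul_div_cancel₀ γ hβ.ne'
  set δ := γ / β
  set T := A.invSqrt with hT
  obtain ⟨B, hB, hTB, hlim1, hlim2⟩ :=
    exists_approximate_inverse T A.isSymmetric_invSqrt A.inner_invSqrt_nonneg
  obtain ⟨M, ω, hω, hbound⟩ := norm_expGroup_blockOperator_le (H := H) δ (δ - α) η hβ hκ
  have hTinj : Function.Injective ⇑(T ^ 4) := by
    intro x y h
    simp only [pow_succ, pow_zero, one_mul] at h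
    exact A.invSqrt_injective (A.invSqrt_injective (A.invSqrt_injective (A.invSqrt_injective h)))
  have hTdense : DenseRange ⇑(T ^ 4) := by
    refine denseRange_of_isSymmetric_of_injective ?_ hTinj
    have hs : ∀ x y, inner ℝ (T x) y = inner ℝ x (T y) := A.inner_invSqrt
    intro x y
    simp [pow_succ, hs]
  obtain ⟨S, hS, hSd, hSu⟩ := exists_semigroup_of_approximation
    (fun n => blockOperator δ (δ - α) β κ η 1 (B n) (B n ^ 2)) (diagOperator (T ^ 4))
    (blockOperator δ (δ - α) β κ η (T ^ 4) (T ^ 3) (T ^ 2)) hω (fun n => hbound (B n) (hB n))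
    (fun n => commute_diagOperator_blockOperator _ _ _ _ _ (Commute.one_right _)
      ((hTB n).pow_left 4) ((hTB n).pow_pow 4 2))
    (by
      simp only [blockOperator_mul_diagOperator, one_mul]
      exact tendsto_blockOperator _ _ _ _ _ tendsto_const_nhds hlim1 hlim2)
    (denseRange_diagOperator hTdense) (injective_diagOperator hTinj)
  set Φ := A.coordinates α δ with hΦ
  -- The semigroup is transported back to the phase space by conjugation with the coordinates.
  let S' : ℝ≥0 → A.PhaseSpace →L[ℝ] A.PhaseSpace := fun t =>
    (Φ.symm : (H × H × H × H) →L[ℝ] A.PhaseSpace).comp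
      ((S t).comp (Φ : A.PhaseSpace →L[ℝ] (H × H × H × H)))
  have hS'a : ∀ t z, S' t z = Φ.symm (S t (Φ z)) := fun t z => rfl
  have hS' : IsStronglyContinuousSemigroup S' := by
    refine ⟨?_, fun s t => ?_, fun z => ?_⟩
    · refine ContinuousLinearMap.ext fun z => ?_
      simp [hS'a, hS.zero]
    · refine ContinuousLinearMap.ext fun z => ?_
      simp [hS'a, hS.add]
    · exact Φ.symm.continuous.comp (hS.continuous (Φ z))
  have huniq : ∀ (z : A.PhaseSpace) (U : C(ℝ≥0, A.PhaseSpace)),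
      A.IsWeakSolution α β γ κ η z U → ∀ t : ℝ≥0, U t = S' t z := by
    intro z U hU t
    obtain ⟨h0, h1⟩ := (A.isWeakSolution_iff_coordinates hδ).1 hU
    have h2 := hSu (fun s => Φ (U s.toNNReal))
      (Φ.continuous.comp (U.continuous.comp continuous_real_toNNReal)) h1 t
    simp only [Real.toNNReal_coe, Real.toNNReal_zero, h0] at h2
    rw [hS'a, ← h2, Φ.symm_apply_apply]
  refine ⟨fun z => ⟨⟨fun t => S' t z, hS'.continuous z⟩, ?_, fun U hU => ?_⟩, S', hS', huniq⟩
  · refine (A.isWeakSolution_iff_coordinates hδ).2 ⟨?_, fun t ht => ?_⟩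
    · simp [hS'.zero]
    · have h := hSd (Φ z) t ht
      simpa only [ContinuousMap.coe_mk, hS'a, ← hΦ, Φ.apply_symm_apply] using h
  · ext1 t
    exact huniq z U hU t
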